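/- **Setting.** Fix $\alpha\in(0,1)$, $g>0$, $\sigma>0$, $p_0<0$, a nonincreasing positive density $\rho\in C^{2+\alpha}([p_0,0])$ and a Bernoulli function $\beta\in C^{1+\alpha}([0,|p_0|])$. Put $B(p)=\int_0^p\beta(-s)\,ds$, $B_{\min}=\min_{[p_0,0]}B$, and fix any $\epsilon_0>0$ with $$\epsilon_0^{3/2}\ \ge\ \max\{\,2g\|\rho'\|_{L^\infty}p_0^2e^{|p_0|},\ (2g\|\rho'\|_{L^\infty})^3\,\}.$$ For a function $h(q,p)$ that is $2\pi$-periodic in $q$ let $d(h)=\frac1{2\pi}\int_0^{2\pi}h(q,0)\,dq$. For $\lambda>-2B_{\min}$ let $(H(\cdot;\lambda),Q(\lambda))$ be the laminar flow: $H_p>0$, $$H_{pp}-gH_p^3(H-H(0))\rho_p=-H_p^3\beta(-p)\ \text{ on }(p_0,0),\qquad 1+H_p(0)^2(2g\rho(0)H(0)-Q)=0,\qquad H(p_0)=0,\qquad H_p(0)=\lambda^{-1/2},$$ and put $Y=H-H(0)$, $\dot Y=\partial Y/\partial\lambda$. Let $X$ be the space of $C^{3+\alpha}$ functions on $\{(q,p):p_0\le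 p\le0\}$ that are $2\pi$-periodic and even in $q$ and vanish at $p=p_0$. For $w\in X$ let $\mathcal F=(\mathcal F_1,\mathcal F_2)$, $$\mathcal F_1(\lambda,w)=(1+w_q^2)(H_{pp}+w_{pp})+w_{qq}(H_p+w_p)^2-2w_qw_{pq}(H_p+w_p)-g(H+w-d(H)-d(w))(H_p+w_p)^3\rho_p+(H_p+w_p)^3\beta(-p),$$ $$\mathcal F_2(\lambda,w)=\Big[1+w_q^2+(H_p+w_p)^2\big(2\sigma\kappa[w]+2g\rho(H+w)-Q\big)\Big]_{p=0},\qquad \kappa[w]=-\frac{w_{qq}}{(1+w_q^2)^{3/2}},$$ and let $\mathcal F_w(\lambda,0)$ be its linearization at $w=0$. For an integer $n\ge0$, the mode-$n$ Sturm–Liouville problem at $\lambda$ is $$(H_p^{-3}M_p)_p=(n^2H_p^{-1}+g\rho_p)M-g\rho_p\,\delta_{n0}M(0)\ \text{ on }(p_0,0),\qquad M(p_0)=0,\qquad \lambda^{3/2}M_p(0)=(n^2\sigma+g\rho(0))M(0).$$ Let $\lambda_0$ denote the unique minimum point of $Q$ on $(-2B_{\min}+\epsilon_0,\infty)$; if there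 is none, "$\lambda=\lambda_0$" is false for every $\lambda$. Let $\lambda_c$ be any real number such that $$4\dot Y(p_0;\lambda)<\frac1{g\rho(0)+g\|\rho'\|_{L^\infty}|p_0|}\qquad\text{for all }\lambda>-2B_{\min}+\epsilon_0\text{ with }\lambda>\lambda_c;$$ if $\rho$ is constant, $\lambda_c=\lambda_0$ (when $\lambda_0$ exists) is also allowed. **Theorem (Null space).** Let $\lambda_*>-2B_{\min}+\epsilon_0$ be such that the mode-$1$ problem has a nontrivial solution at $\lambda_*$. Then: 1. if $\lambda_*\ne\lambda_0$, the null space of $\mathcal F_w(\lambda_*,0)$ on $X$ is at most two-dimensional; 2. if $\lambda_*>\lambda_c$, the null space of $\mathcal F_w(\lambda_*,0)$ is one-dimensional; 3. the mode-$0$ problem has a nontrivial solution at $\lambda_*$ (zero is an eigenvalue) if and only if $\lambda_*=\lambda_0$. -/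

import Mathlib

open Set

noncomputable section

/-- `f` is Hölder continuous of exponent `α` on `s`. -/
def IsHolderOn {E F : Type*} [PseudoMetricSpace E] [SeminormedAddCommGroup F]
    (α : ℝ) (f : E → F) (s : Set E) : Prop :=
  ∃ C : ℝ, ∀ x ∈ s, ∀ y ∈ s, ‖f x - f y‖ ≤ C * dist x y ^ α

/-- `f` belongs to `C^{k+α}([a,b])`. -/
def IsHolderClass (k : ℕ) (α : ℝ) (f : ℝ → ℝ) (a b : ℝ) : Prop :=
  ContDiffOn ℝ k f (Icc a b) ∧ IsHolderOn α (iteratedDerivWithin k f (Icc a b)) (Icc a b)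

/-- The given data of the stratified capillary-gravity water wave problem (period `2π`). -/
structure WaveData where
  /-- gravitational constant -/
  g : ℝ
  /-- coefficient of surface tension -/
  sigma : ℝ
  /-- relative pseudo-mass flux -/
  p0 : ℝ
  /-- Hölder exponent -/
  alpha : ℝ
  /-- streamline density function; only its values on `[p0, 0]` matter -/
  rho : ℝ → ℝ
  /-- Bernoulli function; only its values on `[0, |p0|]` matter -/
  beta : ℝ → ℝ
  g_pos : 0 < g
  sigma_pos : 0 < sigma
  p0_neg : p0 < 0
  alpha_pos : 0 < alpha
  alpha_lt_one : alpha < 1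
  rho_class : IsHolderClass 2 alpha rho p0 0
  rho_pos : ∀ p ∈ Icc p0 0, 0 < rho p
  rho_antitone : AntitoneOn rho (Icc p0 0)
  beta_class : IsHolderClass 1 alpha beta 0 |p0|

namespace WaveData

variable (d : WaveData)

/-- The interval `[p0, 0]`. -/
def I : Set ℝ := Icc d.p0 0

/-- The closed strip `{(q, p) : p0 ≤ p ≤ 0}`; functions on the closed rectangle which are
`2π`-periodic in `q` are identified with `2π`-periodic functions on the strip. -/
def strip : Set (ℝ × ℝ) := univ ×ˢ d.I

/-- Derivative of a function on `[p0, 0]` (one-sided at the end points). -/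
def D (f : ℝ → ℝ) : ℝ → ℝ := derivWithin f d.I

/-- `‖ρ'‖_{L^∞}` on `[p0, 0]`. -/
def rhoSup : ℝ := sSup ((fun p => |d.D d.rho p|) '' d.I)

/-- `B(p) = ∫_0^p β(-s) ds`. -/
def B (p : ℝ) : ℝ := ∫ s in (0 : ℝ)..p, d.beta (-s)

/-- Minimum of `B` on `[p0, 0]`. -/
def Bmin : ℝ := sInf (d.B '' d.I)

/-! ### Laminar flows -/

/-- `(H, Q)` is the laminar solution of the height equation with parameter `lam`.
Since `H` does not depend on `q`, its average over the top is `d(H) = H 0`. -/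
structure IsLaminar (lam : ℝ) (H : ℝ → ℝ) (Q : ℝ) : Prop where
  contDiffOn : ContDiffOn ℝ 2 H d.I
  deriv_pos : ∀ p ∈ d.I, 0 < d.D H p
  ode : ∀ p ∈ Ioo d.p0 0,
    d.D (d.D H) p - d.g * d.D H p ^ 3 * (H p - H 0) * d.D d.rho p
      = - d.D H p ^ 3 * d.beta (-p)
  top : 1 + d.D H 0 ^ 2 * (2 * d.g * d.rho 0 * H 0 - Q) = 0
  bottom : H d.p0 = 0
  param : d.D H 0 = lam ^ (-(1 / 2) : ℝ)

/-- The laminar flow `(H(·; lam), Q(lam))`. -/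
def laminar (lam : ℝ) : (ℝ → ℝ) × ℝ :=
  Classical.epsilon fun HQ : (ℝ → ℝ) × ℝ => d.IsLaminar lam HQ.1 HQ.2

/-- `H(·; lam)`. -/
def H (lam : ℝ) : ℝ → ℝ := (d.laminar lam).1

/-- `Q(lam)`. -/
def Q (lam : ℝ) : ℝ := (d.laminar lam).2

/-- `Y(p; lam) = H(p; lam) - d(H(·; lam))`. -/
def Y (lam p : ℝ) : ℝ := d.H lam p - d.H lam 0

/-- `∂Y/∂lam`. -/
def Ydot (lam p : ℝ) : ℝ := deriv (fun mu => d.Y mu p) lam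

/-! ### Function space -/

/-- Partial derivative in `q`. -/
def dq (w : ℝ × ℝ → ℝ) (x : ℝ × ℝ) : ℝ := deriv (fun t => w (t, x.2)) x.1

/-- Partial derivative in `p` on the strip (one-sided at the boundary). -/
def dp (w : ℝ × ℝ → ℝ) (x : ℝ × ℝ) : ℝ := derivWithin (fun s => w (x.1, s)) d.I x.2

/-- The average `d(h)` of `h` over one period of the top. -/
def depth (h : ℝ × ℝ → ℝ) : ℝ := (2 * Real.pi)⁻¹ * ∫ q in (0 : ℝ)..(2 * Real.pi), h (q, 0)

theorem uniqueDiffOn_I : UniqueDiffOn ℝ d.I := uniqueDiffOn_Icc d.p0_neg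

theorem uniqueDiffOn_strip : UniqueDiffOn ℝ d.strip :=
  uniqueDiffOn_univ.prod d.uniqueDiffOn_I

/-- The space `X` of functions of class `C^{3+α}` on the closed strip that are `2π`-periodic and
even in `q` and vanish on the bottom. A function on the strip is represented by its extension
by zero, so that elements of `X` are equal iff they agree on the strip. -/
def X : Submodule ℝ (ℝ × ℝ → ℝ) where
  carrier := {w | (∀ x, x ∉ d.strip → w x = 0) ∧
    (∀ q p, w (q + 2 * Real.pi, p) = w (q, p)) ∧
    (∀ q p, w (-q, p) = w (q, p)) ∧
    (∀ q, w (q, d.p0) = 0) ∧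
    ContDiffOn ℝ 3 w d.strip ∧
    IsHolderOn d.alpha (iteratedFDerivWithin ℝ 3 w d.strip) d.strip}
  zero_mem' := by
    refine ⟨by simp, by simp, by simp, by simp, contDiffOn_const, 0, ?_⟩
    intro x _ y _
    have h : iteratedFDerivWithin ℝ 3 (0 : ℝ × ℝ → ℝ) d.strip = 0 :=
      iteratedFDerivWithin_fun_zero
    simp [h]
  add_mem' := by
    rintro a b ⟨a1, a2, a3, a4, a5, Ca, a6⟩ ⟨b1, b2, b3, b4, b5, Cb, b6⟩
    refine ⟨fun x hx => by simp [a1 x hx, b1 x hx], fun q p => by simp [a2 q p, b2 q p],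
      fun q p => by simp [a3 q p, b3 q p], fun q => by simp [a4 q, b4 q], a5.add b5,
      Ca + Cb, ?_⟩
    intro x hx y hy
    have h : ∀ z ∈ d.strip, iteratedFDerivWithin ℝ 3 (a + b) d.strip z =
        iteratedFDerivWithin ℝ 3 a d.strip z + iteratedFDerivWithin ℝ 3 b d.strip z :=
      fun z hz => iteratedFDerivWithin_add_apply (a5 z hz) (b5 z hz) d.uniqueDiffOn_strip hz
    rw [h x hx, h y hy, add_sub_add_comm, add_mul]
    exact (norm_add_le _ _).trans (add_le_add (a6 x hx y hy) (b6 x hx y hy))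
  smul_mem' := by
    rintro c a ⟨a1, a2, a3, a4, a5, Ca, a6⟩
    refine ⟨fun x hx => by simp [a1 x hx], fun q p => by simp [a2 q p],
      fun q p => by simp [a3 q p], fun q => by simp [a4 q], a5.const_smul c,
      |c| * Ca, ?_⟩
    intro x hx y hy
    have h : ∀ z ∈ d.strip, iteratedFDerivWithin ℝ 3 (c • a) d.strip z =
        c • iteratedFDerivWithin ℝ 3 a d.strip z :=
      fun z hz => iteratedFDerivWithin_const_smul_apply (a5 z hz) d.uniqueDiffOn_strip hz
    rw [h x hx, h y hy, ← smul_sub, norm_smul, Real.norm_eq_abs, mul_assoc]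
    exact mul_le_mul_of_nonneg_left (a6 x hx y hy) (abs_nonneg c)

/-! ### The nonlinear operator and its linearization -/

/-- Interior component of the nonlinear operator at `(lam, w)`, evaluated at `x = (q, p)`. -/
def F1 (lam : ℝ) (w : ℝ × ℝ → ℝ) (x : ℝ × ℝ) : ℝ :=
  (1 + dq w x ^ 2) * (d.D (d.D (d.H lam)) x.2 + d.dp (d.dp w) x)
    + dq (dq w) x * (d.D (d.H lam) x.2 + d.dp w x) ^ 2
    - 2 * dq w x * dq (d.dp w) x * (d.D (d.H lam) x.2 + d.dp w x)
    - d.g * (d.H lam x.2 + w x - d.H lam 0 - depth w)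
        * (d.D (d.H lam) x.2 + d.dp w x) ^ 3 * d.D d.rho x.2
    + (d.D (d.H lam) x.2 + d.dp w x) ^ 3 * d.beta (-x.2)

/-- The curvature `κ[w] = - w_qq (1 + w_q²)^{-3/2}`. -/
def curvature (w : ℝ × ℝ → ℝ) (x : ℝ × ℝ) : ℝ :=
  - dq (dq w) x / (1 + dq w x ^ 2) ^ (3 / 2 : ℝ)

/-- Boundary component of the nonlinear operator at `(lam, w)`, evaluated at the point `(q, 0)`
of the top. -/
def F2 (lam : ℝ) (w : ℝ × ℝ → ℝ) (q : ℝ) : ℝ :=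
  1 + dq w (q, 0) ^ 2
    + (d.D (d.H lam) 0 + d.dp w (q, 0)) ^ 2
      * (2 * d.sigma * curvature w (q, 0)
          + 2 * d.g * d.rho 0 * (d.H lam 0 + w (q, 0)) - d.Q lam)

theorem dq_smul (t : ℝ) (w : ℝ × ℝ → ℝ) : dq (t • w) = t • dq w := by
  funext x
  simp [dq, deriv_const_mul_field]

theorem dp_smul (t : ℝ) (w : ℝ × ℝ → ℝ) : d.dp (t • w) = t • d.dp w := by
  funext x
  simp [dp, derivWithin_const_mul_field]

theorem depth_smul (t : ℝ) (w : ℝ × ℝ → ℝ) : depth (t • w) = t * depth w := by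
  simp only [depth, Pi.smul_apply, smul_eq_mul, intervalIntegral.integral_const_mul]
  ring

theorem lineDeriv_F1 (lam : ℝ) (w : ℝ × ℝ → ℝ) (x : ℝ × ℝ) :
    lineDeriv ℝ (fun v => d.F1 lam v x) 0 w =
      d.dp (d.dp w) x + d.D (d.H lam) x.2 ^ 2 * dq (dq w) x
        - d.g * d.D d.rho x.2 * (3 * d.dp w x * (d.H lam x.2 - d.H lam 0)
            * d.D (d.H lam) x.2 ^ 2 + (w x - depth w) * d.D (d.H lam) x.2 ^ 3)
        + 3 * d.D (d.H lam) x.2 ^ 2 * d.beta (-x.2) * d.dp w x := by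
  unfold lineDeriv
  apply HasDerivAt.deriv
  simp only [F1, zero_add, dq_smul, dp_smul, depth_smul, Pi.smul_apply, smul_eq_mul]
  generalize d.dp (d.dp w) x = wpp
  generalize dq (dq w) x = wqq
  generalize dq (d.dp w) x = wpq
  generalize d.dp w x = wp
  generalize dq w x = wq
  generalize depth w = dw
  generalize w x = w0
  generalize d.D (d.D (d.H lam)) x.2 = Hpp
  generalize d.D (d.H lam) x.2 = Hp
  generalize d.H lam x.2 = h
  generalize d.H lam 0 = h0
  have L : ∀ c : ℝ, HasDerivAt (fun t : ℝ => t * c) c 0 := fun c => by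
    simpa using (hasDerivAt_id (0 : ℝ)).mul_const c
  have A := ((L wq).pow 2).const_add 1
  have E := (L wp).const_add Hp
  have T1 := A.mul ((L wpp).const_add Hpp)
  have T2 := (L wqq).mul (E.pow 2)
  have T3 := (((L wq).const_mul 2).mul (L wpq)).mul E
  have T4 := (((((L w0).const_add h).sub_const h0).sub (L dw)).const_mul d.g).mul (E.pow 3)
  have T := (((T1.add T2).sub T3).sub (T4.mul_const (d.D d.rho x.2))).add
    ((E.pow 3).mul_const (d.beta (-x.2)))
  refine (T.congr_deriv ?_).congr_of_eventuallyEq (Filter.Eventually.of_forall fun t => ?_)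
  · simp
    ring
  · simp

theorem lineDeriv_F2 (lam : ℝ) (w : ℝ × ℝ → ℝ) (q : ℝ) :
    lineDeriv ℝ (fun v => d.F2 lam v q) 0 w =
      d.D (d.H lam) 0 ^ 2 * (2 * d.g * d.rho 0 * w (q, 0) - 2 * d.sigma * dq (dq w) (q, 0))
        + 2 * d.D (d.H lam) 0 * (2 * d.g * d.rho 0 * d.H lam 0 - d.Q lam) * d.dp w (q, 0) := by
  unfold lineDeriv
  apply HasDerivAt.deriv
  simp only [F2, curvature, zero_add, dq_smul, dp_smul, Pi.smul_apply, smul_eq_mul]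
  generalize dq (dq w) (q, 0) = wqq
  generalize d.dp w (q, 0) = wp
  generalize dq w (q, 0) = wq
  generalize w (q, 0) = w0
  generalize d.D (d.H lam) 0 = Hp
  generalize d.H lam 0 = h
  have L : ∀ c : ℝ, HasDerivAt (fun t : ℝ => t * c) c 0 := fun c => by
    simpa using (hasDerivAt_id (0 : ℝ)).mul_const c
  have A := ((L wq).pow 2).const_add 1
  have E := (L wp).const_add Hp
  have R := A.rpow_const (p := (3 / 2 : ℝ)) (Or.inl (by simp))
  have K := (L wqq).neg.div R (by simp)
  have T := A.add ((E.pow 2).mul (((K.const_mul (2 * d.sigma)).add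
    (((L w0).const_add h).const_mul (2 * d.g * d.rho 0))).sub_const (d.Q lam)))
  refine (T.congr_deriv ?_).congr_of_eventuallyEq (Filter.Eventually.of_forall fun t => ?_)
  · simp
    ring
  · simp

theorem mapsTo_q {p : ℝ} (hp : p ∈ d.I) : MapsTo (fun t : ℝ => (t, p)) univ d.strip :=
  fun _ _ => ⟨mem_univ _, hp⟩

theorem mapsTo_p (q : ℝ) : MapsTo (fun s : ℝ => (q, s)) d.I d.strip :=
  fun _ hs => ⟨mem_univ _, hs⟩

theorem contDiff_q {w : ℝ × ℝ → ℝ} (hw : ContDiffOn ℝ 3 w d.strip) {p : ℝ} (hp : p ∈ d.I) :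
    ContDiff ℝ 3 fun t => w (t, p) :=
  contDiffOn_univ.1 (hw.comp (contDiff_id.prodMk contDiff_const).contDiffOn (d.mapsTo_q hp))

theorem contDiffOn_p {w : ℝ × ℝ → ℝ} (hw : ContDiffOn ℝ 3 w d.strip) (q : ℝ) :
    ContDiffOn ℝ 3 (fun s => w (q, s)) d.I :=
  hw.comp (contDiff_const.prodMk contDiff_id).contDiffOn (d.mapsTo_p q)

theorem dq_add {a b : ℝ × ℝ → ℝ} (ha : ContDiffOn ℝ 3 a d.strip) (hb : ContDiffOn ℝ 3 b d.strip)
    {x : ℝ × ℝ} (hx : x.2 ∈ d.I) : dq (a + b) x = dq a x + dq b x :=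
  deriv_add ((d.contDiff_q ha hx).differentiable (by norm_num)).differentiableAt
    ((d.contDiff_q hb hx).differentiable (by norm_num)).differentiableAt

theorem dp_add {a b : ℝ × ℝ → ℝ} (ha : ContDiffOn ℝ 3 a d.strip) (hb : ContDiffOn ℝ 3 b d.strip)
    {x : ℝ × ℝ} (hx : x.2 ∈ d.I) : d.dp (a + b) x = d.dp a x + d.dp b x :=
  derivWithin_add ((d.contDiffOn_p ha x.1).differentiableOn (by norm_num) _ hx)
    ((d.contDiffOn_p hb x.1).differentiableOn (by norm_num) _ hx)

theorem dqq_add {a b : ℝ × ℝ → ℝ} (ha : ContDiffOn ℝ 3 a d.strip)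
    (hb : ContDiffOn ℝ 3 b d.strip) {x : ℝ × ℝ} (hx : x.2 ∈ d.I) :
    dq (dq (a + b)) x = dq (dq a) x + dq (dq b) x := by
  have h : ∀ {c : ℝ × ℝ → ℝ}, ContDiffOn ℝ 3 c d.strip →
      Differentiable ℝ fun t => dq c (t, x.2) := fun hc =>
    ((contDiff_succ_iff_deriv (n := 2)).1 (d.contDiff_q hc hx)).2.2.differentiable (by norm_num)
  have e : (fun t => dq (a + b) (t, x.2)) = (fun t => dq a (t, x.2)) + fun t => dq b (t, x.2) :=
    funext fun t => d.dq_add ha hb hx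
  rw [dq, e]
  exact deriv_add (h ha).differentiableAt (h hb).differentiableAt

theorem dpp_add {a b : ℝ × ℝ → ℝ} (ha : ContDiffOn ℝ 3 a d.strip)
    (hb : ContDiffOn ℝ 3 b d.strip) {x : ℝ × ℝ} (hx : x.2 ∈ d.I) :
    d.dp (d.dp (a + b)) x = d.dp (d.dp a) x + d.dp (d.dp b) x := by
  have h : ∀ {c : ℝ × ℝ → ℝ}, ContDiffOn ℝ 3 c d.strip →
      DifferentiableOn ℝ (fun s => d.dp c (x.1, s)) d.I := fun hc =>
    ((d.contDiffOn_p hc x.1).derivWithin d.uniqueDiffOn_I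
      (m := 2) (by norm_num)).differentiableOn (by norm_num)
  have e : EqOn (fun s => d.dp (a + b) (x.1, s))
      ((fun s => d.dp a (x.1, s)) + fun s => d.dp b (x.1, s)) d.I :=
    fun s hs => d.dp_add ha hb (x := (x.1, s)) hs
  rw [dp, derivWithin_congr e (e hx)]
  exact derivWithin_add (h ha _ hx) (h hb _ hx)

theorem zero_mem_I : (0 : ℝ) ∈ d.I := ⟨d.p0_neg.le, le_rfl⟩

theorem depth_add {a b : ℝ × ℝ → ℝ} (ha : ContDiffOn ℝ 3 a d.strip)
    (hb : ContDiffOn ℝ 3 b d.strip) : depth (a + b) = depth a + depth b := by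
  simp only [depth, Pi.add_apply]
  rw [intervalIntegral.integral_add
    ((d.contDiff_q ha d.zero_mem_I).continuous.intervalIntegrable _ _)
    ((d.contDiff_q hb d.zero_mem_I).continuous.intervalIntegrable _ _), mul_add]

/-- The linearized operator `F_w(lam, 0)`: the derivative at `w = 0` of the nonlinear operator
`(F1, F2)(lam, ·)`, evaluated at the points of the closed strip and of the top respectively. -/
def linearization (lam : ℝ) : d.X →ₗ[ℝ] (d.strip → ℝ) × (ℝ → ℝ) where
  toFun w := (fun x => lineDeriv ℝ (fun v : ℝ × ℝ → ℝ => d.F1 lam v x) 0 (w : ℝ × ℝ → ℝ),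
    fun q => lineDeriv ℝ (fun v : ℝ × ℝ → ℝ => d.F2 lam v q) 0 (w : ℝ × ℝ → ℝ))
  map_add' a b := by
    have ha := a.2.2.2.2.2.1
    have hb := b.2.2.2.2.2.1
    refine Prod.ext (funext fun x => ?_) (funext fun q => ?_)
    · have hx : (x : ℝ × ℝ).2 ∈ d.I := x.2.2
      simp only [Submodule.coe_add, Prod.fst_add, Pi.add_apply, lineDeriv_F1,
        d.dp_add ha hb hx, d.dqq_add ha hb hx, d.dpp_add ha hb hx, d.depth_add ha hb]
      ring
    · have hx : ((q, 0) : ℝ × ℝ).2 ∈ d.I := d.zero_mem_I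
      simp only [Submodule.coe_add, Prod.snd_add, Pi.add_apply, lineDeriv_F2,
        d.dp_add ha hb hx, d.dqq_add ha hb hx]
      ring
  map_smul' c a := by
    refine Prod.ext (funext fun x => ?_) (funext fun q => ?_)
    · simp only [Submodule.coe_smul, Prod.smul_fst, Pi.smul_apply, lineDeriv_F1, dq_smul, dp_smul,
        depth_smul, smul_eq_mul, RingHom.id_apply]
      ring
    · simp only [Submodule.coe_smul, Prod.smul_snd, Pi.smul_apply, lineDeriv_F2, dq_smul, dp_smul,
        smul_eq_mul, RingHom.id_apply]
      ring

/-- The null space of `F_w(lam, 0)`. -/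
def nullSpace (lam : ℝ) : Submodule ℝ d.X := LinearMap.ker (d.linearization lam)

/-! ### Sturm–Liouville problems for the cosine modes and distinguished parameter values -/

/-- `M` solves the Sturm–Liouville problem for the mode `M(p) cos(nq)` at the parameter `lam`. -/
structure IsModeSolution (lam : ℝ) (n : ℕ) (M : ℝ → ℝ) : Prop where
  contDiffOn : ContDiffOn ℝ 2 M d.I
  ode : ∀ p ∈ Ioo d.p0 0,
    d.D (fun s => (d.D (d.H lam) s ^ 3)⁻¹ * d.D M s) p
      = ((n : ℝ) ^ 2 * (d.D (d.H lam) p)⁻¹ + d.g * d.D d.rho p) * M p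
        - d.g * d.D d.rho p * (if n = 0 then M 0 else 0)
  bottom : M d.p0 = 0
  top : lam ^ (3 / 2 : ℝ) * d.D M 0 = ((n : ℝ) ^ 2 * d.sigma + d.g * d.rho 0) * M 0

/-- The Sturm–Liouville problem for the mode `n` has a nontrivial solution at `lam`. -/
def HasMode (lam : ℝ) (n : ℕ) : Prop :=
  ∃ M : ℝ → ℝ, d.IsModeSolution lam n M ∧ ∃ p ∈ d.I, M p ≠ 0

/-- Admissible choices of the constant `ε₀ > 0`. -/
def IsThreshold (eps : ℝ) : Prop :=
  0 < eps ∧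
  2 * d.g * d.rhoSup * d.p0 ^ 2 * Real.exp |d.p0| ≤ eps ^ (3 / 2 : ℝ) ∧
  (2 * d.g * d.rhoSup) ^ 3 ≤ eps ^ (3 / 2 : ℝ)

/-- The range `(-2 B_min + ε₀, ∞)` of the parameter. -/
def params (eps : ℝ) : Set ℝ := Ioi (-2 * d.Bmin + eps)

/-- `lam = λ₀`: `lam` is the unique minimum point of `Q` on the range of the parameter. -/
def IsLambdaZero (eps lam : ℝ) : Prop :=
  lam ∈ d.params eps ∧ ∀ mu ∈ d.params eps, mu ≠ lam → d.Q lam < d.Q mu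

/-- `lamC` is an admissible choice of `λ_c`; for constant density `λ_c = λ₀` is admissible too. -/
def IsLambdaC (eps lamC : ℝ) : Prop :=
  (∀ lam ∈ d.params eps, lamC < lam →
    4 * d.Ydot lam d.p0 < 1 / (d.g * d.rho 0 + d.g * d.rhoSup * |d.p0|)) ∨
  ((∀ p ∈ d.I, d.rho p = d.rho 0) ∧ d.IsLambdaZero eps lamC)

end WaveData

end

/-! Let u = 1/H_p be the speed and f = H(0) - H the depth below the surface. The height equation
integrates to u² = lam - 2∫_p^0 β(-s) ds + 2∫_p^0 (-gρ') f, with f = ∫_p^0 1/u. On the parameter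
range u ≥ √eps, and the threshold on eps makes the Volterra operators with kernels u⁻³ and -gρ'
strict contractions. This yields existence of the flow (`exists_isLaminar`), its differentiability
in lam, and a lower bound for k = ∂Y/∂lam (`IsVariation.lower_bound`).

Here Q = lam + 2gρ(0) f(p0) and Q' = 1 - 2gρ(0) k(p0). Since x^(-1/2) is convex, f(p0) lies strictly
above its tangents as a function of lam, hence so does Q (`tangent_lt_Q`): lam is the minimum point
exactly when Q'(lam) = 0. A mode-0 solution is a multiple of 1 - 2gρ(0) k, by uniqueness for the
Volterra equation, and its bottom condition is again Q' = 0 (`hasMode_zero_iff`). This proves the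
third claim.

The cosine coefficients of a null vector solve the mode problems (`cosCoeff_isModePair`), a mode n ≥
1 is determined by its top value (`eq_zero_of_top`), and an even periodic function with vanishing
cosine coefficients is zero. So, if mode 0 is absent, the nullity is at most the number of modes
that occur.

To count modes, normalize M_n(0) = 1 and put x_n = σ - ∫ u M_n². Testing two modes against each
other gives σ = ∫ u M_n M_m. The difference M_n - M_m vanishes at both ends; positivity of ∫ u (M_n
- M_m)² gives x_n + x_m < 0, and positivity of its energy gives n² x_n + m² x_m ≥ 0
(`pair_relations`). Thus of any two modes exactly one has x < 0, which is impossible among three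
(`not_three_modes`). Beyond λ_c the energy form is nonnegative on the modes themselves, so every x_n
≥ 0 and two modes already contradict x_n + x_m < 0 (`mode_unique`); mode 0 is excluded there too.
Conversely M_1(p) cos q is a null vector, and a bootstrap in the equations puts it in C^{3+α}. -/

/-! ### Volterra equations with small kernel. -/

/-- The iterated Volterra operator `e ↦ ∫_p^0 c(s) ∫_s^0 r(t) e(t) dt ds`. -/
noncomputable def volterra (c r e : ℝ → ℝ) (p : ℝ) : ℝ := ∫ s in p..0, c s * ∫ t in s..0, r t * e t

theorem continuous_integral_to_zero {f : ℝ → ℝ} (hf : Continuous f) :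
    Continuous fun p => ∫ s in p..0, f s := by
  have h : (fun p => ∫ s in p..0, f s) = fun p => -∫ s in (0 : ℝ)..p, f s :=
    funext fun p => intervalIntegral.integral_symm _ _
  rw [h]
  exact (intervalIntegral.continuous_primitive (fun _ _ => hf.intervalIntegrable _ _) 0).neg

theorem hasDerivAt_integral_to_zero {f : ℝ → ℝ} (hf : Continuous f) (p : ℝ) :
    HasDerivAt (fun p => ∫ s in p..0, f s) (-f p) p :=
  intervalIntegral.integral_hasDerivAt_left (hf.intervalIntegrable _ _)
    (hf.stronglyMeasurableAtFilter _ _) hf.continuousAt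

theorem abs_integral_to_zero_le {f : ℝ → ℝ} {p C : ℝ} (hp : p ≤ 0)
    (h : ∀ s ∈ Icc p 0, |f s| ≤ C) : |∫ s in p..0, f s| ≤ C * -p := by
  have := intervalIntegral.norm_integral_le_of_norm_le_const (a := p) (b := 0) (f := f) (C := C)
    (fun s hs => by
      rw [uIoc_of_le hp] at hs
      exact h s ⟨hs.1.le, hs.2⟩)
  rwa [zero_sub, abs_neg, abs_of_nonpos hp] at this

/-- An integrand dominated by `-K s` on `[p,0]`. -/
theorem abs_integral_to_zero_le_sq {f : ℝ → ℝ} {p K : ℝ} (hp : p ≤ 0)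
    (h : ∀ s ∈ Icc p 0, |f s| ≤ K * -s) : |∫ s in p..0, f s| ≤ K * p ^ 2 / 2 := by
  have h1 : |∫ s in p..0, f s| ≤ ∫ s in p..0, K * -s :=
    (Real.norm_eq_abs _).symm.le.trans <| intervalIntegral.norm_integral_le_of_norm_le hp
      (Filter.Eventually.of_forall fun s hs => h s ⟨hs.1.le, hs.2⟩)
      ((by fun_prop : Continuous fun s : ℝ => K * -s).intervalIntegrable _ _)
  refine h1.trans (le_of_eq ?_)
  rw [intervalIntegral.integral_const_mul, intervalIntegral.integral_neg, integral_id]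
  ring

theorem volterra_abs_le {c r e : ℝ → ℝ} {p C R S : ℝ} (hp : p ≤ 0)
    (hC : ∀ s ∈ Icc p 0, |c s| ≤ C) (hR : ∀ s ∈ Icc p 0, |r s| ≤ R)
    (hS : ∀ s ∈ Icc p 0, |e s| ≤ S) : |volterra c r e p| ≤ C * R * S * p ^ 2 / 2 := by
  have h0 : (0 : ℝ) ∈ Icc p 0 := ⟨hp, le_rfl⟩
  have hC0 := (abs_nonneg _).trans (hC 0 h0)
  have hR0 := (abs_nonneg _).trans (hR 0 h0)
  refine abs_integral_to_zero_le_sq hp fun s hs => ?_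
  have : |∫ t in s..0, r t * e t| ≤ R * S * -s :=
    abs_integral_to_zero_le hs.2 fun t ht => by
      rw [abs_mul]
      exact mul_le_mul (hR t ⟨hs.1.trans ht.1, ht.2⟩) (hS t ⟨hs.1.trans ht.1, ht.2⟩)
        (abs_nonneg _) hR0
  rw [abs_mul]
  calc |c s| * |∫ t in s..0, r t * e t| ≤ C * (R * S * -s) :=
        mul_le_mul (hC s hs) this (abs_nonneg _) hC0
    _ = C * R * S * -s := by ring

/-- A priori bound for the Volterra equation `e = F - volterra c r e` with small kernel. -/
theorem volterra_solution_abs_le {c r e F : ℝ → ℝ} {p0 C R S : ℝ} (hp0 : p0 ≤ 0)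
    (hC : ∀ s ∈ Icc p0 0, |c s| ≤ C) (hR : ∀ s ∈ Icc p0 0, |r s| ≤ R)
    (hsmall : C * R * p0 ^ 2 ≤ 1 / 2) (he : ContinuousOn e (Icc p0 0))
    (hF : ∀ p ∈ Icc p0 0, |F p| ≤ S) (heq : ∀ p ∈ Icc p0 0, e p = F p - volterra c r e p) :
    ∀ p ∈ Icc p0 0, |e p| ≤ 4 / 3 * S := by
  obtain ⟨m, hm, hmax⟩ := isCompact_Icc.exists_isMaxOn (nonempty_Icc.2 hp0) he.abs
  have hmax' : ∀ s ∈ Icc p0 0, |e s| ≤ |e m| := fun s hs => hmax hs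
  have hsub : ∀ s ∈ Icc m 0, s ∈ Icc p0 0 := fun s hs => ⟨hm.1.trans hs.1, hs.2⟩
  have hv := volterra_abs_le hm.2 (fun s hs => hC s (hsub s hs)) (fun s hs => hR s (hsub s hs))
    (fun s hs => hmax' s (hsub s hs))
  have hC0 := (abs_nonneg _).trans (hC m hm)
  have hR0 := (abs_nonneg _).trans (hR m hm)
  have hsq : m ^ 2 ≤ p0 ^ 2 := by nlinarith [hm.1, hm.2]
  -- At a maximum point of |e| the operator costs at most a quarter of the maximum, whence the
  -- factor 4/3.
  have h1 : C * R * |e m| * m ^ 2 / 2 ≤ |e m| / 4 := by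
    have : C * R * m ^ 2 ≤ 1 / 2 := (mul_le_mul_of_nonneg_left hsq (by positivity)).trans hsmall
    nlinarith [abs_nonneg (e m)]
  have h2 : |e m| ≤ |F m| + |volterra c r e m| := by
    conv_lhs => rw [heq m hm]
    exact abs_sub _ _
  intro p hp
  have := hmax' p hp
  have := hF m hm
  linarith

/-- The inhomogeneity is largest at `p0`; call this value S. The a priori bound gives |e| ≤ 4S/3, so
the Volterra term at `p0` is at most a quarter of that, S/3. -/
theorem volterra_solution_lower_bound {c r e f : ℝ → ℝ} {p0 C R : ℝ} (hp0 : p0 ≤ 0)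
    (hC : ∀ s ∈ Icc p0 0, |c s| ≤ C) (hR : ∀ s ∈ Icc p0 0, |r s| ≤ R)
    (hsmall : C * R * p0 ^ 2 ≤ 1 / 2) (he : ContinuousOn e (Icc p0 0))
    (hf : Continuous f) (hf0 : ∀ s ∈ Icc p0 0, 0 ≤ f s)
    (heq : ∀ p ∈ Icc p0 0, e p = (∫ s in p..0, f s) - volterra c r e p) :
    2 / 3 * (∫ s in p0..0, f s) ≤ e p0 := by
  have hF : ∀ p ∈ Icc p0 0, |∫ s in p..0, f s| ≤ ∫ s in p0..0, f s := by
    intro p hp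
    have h1 : 0 ≤ ∫ s in p..0, f s :=
      intervalIntegral.integral_nonneg hp.2 fun s hs => hf0 s ⟨hp.1.trans hs.1, hs.2⟩
    have h2 : 0 ≤ ∫ s in p0..p, f s :=
      intervalIntegral.integral_nonneg hp.1 fun s hs => hf0 s ⟨hs.1, hs.2.trans hp.2⟩
    have h3 := intervalIntegral.integral_add_adjacent_intervals
      (hf.intervalIntegrable (μ := MeasureTheory.volume) p0 p) (hf.intervalIntegrable p 0)
    rw [abs_of_nonneg h1]
    linarith
  have hb := volterra_solution_abs_le hp0 hC hR hsmall he hF heq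
  have hv := volterra_abs_le hp0 hC hR hb
  have h0 : p0 ∈ Icc p0 0 := ⟨le_rfl, hp0⟩
  have hI := (abs_nonneg _).trans (hF p0 h0)
  rw [heq p0 h0]
  have := (abs_le.1 hv).2
  nlinarith

/-- Solvability of `y(p) = ∫_p^0 V(s, ∫_s^0 r y) ds` for small Lipschitz constants. -/
theorem exists_volterra_fixedPoint {V : ℝ → ℝ → ℝ} {r : ℝ → ℝ} {p0 C R : ℝ} (hp0 : p0 ≤ 0)
    (hV : Continuous fun x : ℝ × ℝ => V x.1 x.2) (hr : Continuous r)
    (hlip : ∀ s ∈ Icc p0 0, ∀ x y, |V s x - V s y| ≤ C * |x - y|)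
    (hR : ∀ s ∈ Icc p0 0, |r s| ≤ R) (hsmall : C * R * p0 ^ 2 ≤ 1 / 2) :
    ∃ y : ℝ → ℝ, Continuous y ∧
      ∀ p ∈ Icc p0 0, y p = ∫ s in p..0, V s (∫ t in s..0, r t * y t) := by
  have h0 : (0 : ℝ) ∈ Icc p0 0 := ⟨hp0, le_rfl⟩
  have hR0 := (abs_nonneg _).trans (hR 0 h0)
  have hC0 : 0 ≤ C := by
    have := (abs_nonneg _).trans (hlip 0 h0 1 0)
    simpa using this
  have hext : ∀ y : C(Icc p0 0, ℝ), Continuous (IccExtend hp0 y) := fun y =>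
    y.continuous.Icc_extend'
  have hin : ∀ y : C(Icc p0 0, ℝ),
      Continuous fun s => V s (∫ t in s..0, r t * IccExtend hp0 y t) := fun y =>
    hV.comp (continuous_id.prodMk (continuous_integral_to_zero (hr.mul (hext y))))
  let Φ : C(Icc p0 0, ℝ) → C(Icc p0 0, ℝ) := fun y =>
    ⟨fun p => ∫ s in (p : ℝ)..0, V s (∫ t in s..0, r t * IccExtend hp0 y t),
      (continuous_integral_to_zero (hin y)).comp continuous_subtype_val⟩
  -- The double integral contributes p²/2, so the actual Lipschitz constant is 1/4; 1/2 is enough.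
  have hΦ : ContractingWith (1 / 2) Φ := by
    refine ⟨by rw [← NNReal.coe_lt_coe]; norm_num, LipschitzWith.of_dist_le_mul fun y z => ?_⟩
    refine (ContinuousMap.dist_le (by positivity)).2 fun p => ?_
    rw [Real.dist_eq]
    change |(∫ s in (p : ℝ)..0, _) - ∫ s in (p : ℝ)..0, _| ≤ _
    rw [← intervalIntegral.integral_sub ((hin y).intervalIntegrable _ _)
      ((hin z).intervalIntegrable _ _)]
    have hp := p.2
    have key : ∀ s ∈ Icc (p : ℝ) 0, |V s (∫ t in s..0, r t * IccExtend hp0 y t)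
        - V s (∫ t in s..0, r t * IccExtend hp0 z t)| ≤ C * R * dist y z * -s := by
      intro s hs
      refine (hlip s ⟨hp.1.trans hs.1, hs.2⟩ _ _).trans ?_
      have hi : ∀ y : C(Icc p0 0, ℝ), IntervalIntegrable
          (fun t => r t * IccExtend hp0 y t) MeasureTheory.volume s 0 := fun y =>
        (hr.mul (hext y)).intervalIntegrable _ _
      rw [← intervalIntegral.integral_sub (hi y) (hi z)]
      have : |∫ t in s..0, (r t * IccExtend hp0 y t - r t * IccExtend hp0 z t)|
          ≤ R * dist y z * -s := by
        refine abs_integral_to_zero_le hs.2 fun t ht => ?_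
        rw [← mul_sub, abs_mul]
        refine mul_le_mul (hR t ⟨hp.1.trans (hs.1.trans ht.1), ht.2⟩) ?_ (abs_nonneg _) hR0
        exact ContinuousMap.dist_apply_le_dist (f := y) (g := z) (projIcc p0 0 hp0 t)
      calc _ ≤ C * (R * dist y z * -s) := mul_le_mul_of_nonneg_left this hC0
        _ = _ := by ring
    refine (abs_integral_to_zero_le_sq hp.2 key).trans ?_
    have hsq : (p : ℝ) ^ 2 ≤ p0 ^ 2 := by nlinarith [hp.1, hp.2]
    have : C * R * (p : ℝ) ^ 2 ≤ 1 / 2 :=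
      (mul_le_mul_of_nonneg_left hsq (by positivity)).trans hsmall
    have hd : 0 ≤ dist y z := dist_nonneg
    push_cast
    nlinarith
  obtain ⟨y, hy, -⟩ := hΦ.exists_fixedPoint 0 (edist_ne_top _ _)
  refine ⟨IccExtend hp0 y, hext y, fun p hp => ?_⟩
  rw [IccExtend_of_mem hp0 y hp]
  exact (DFunLike.congr_fun hy ⟨p, hp⟩).symm

/-- Lipschitz bound for x^(-1/2) on [s², ∞), expressed through square roots because the integral
equation is for the squared speed. -/
theorem abs_inv_sub_inv_le {u v s : ℝ} (hs : 0 < s) (hu : s ≤ u) (hv : s ≤ v) :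
    |u⁻¹ - v⁻¹| ≤ (s ^ 3)⁻¹ / 2 * |u ^ 2 - v ^ 2| := by
  have hu0 := hs.trans_le hu
  have hv0 := hs.trans_le hv
  have h1 : u⁻¹ - v⁻¹ = -((u * v * (u + v))⁻¹ * (u ^ 2 - v ^ 2)) := by
    field_simp
    ring
  have h2 : (u * v * (u + v))⁻¹ ≤ (s ^ 3)⁻¹ / 2 := by
    have h3 : s ^ 3 * 2 ≤ u * v * (u + v) := by
      calc s ^ 3 * 2 = s * s * (s + s) := by ring
        _ ≤ u * v * (u + v) := by gcongr
    calc (u * v * (u + v))⁻¹ ≤ (s ^ 3 * 2)⁻¹ := inv_anti₀ (by positivity) h3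
      _ = (s ^ 3)⁻¹ / 2 := by rw [mul_inv]; ring
  rw [h1, abs_neg, abs_mul, abs_of_pos (by positivity : 0 < (u * v * (u + v))⁻¹)]
  exact mul_le_mul_of_nonneg_right h2 (abs_nonneg _)

/-! ### Calculus on the interval `[p0, 0]`. -/

namespace WaveData

variable (d : WaveData)

/-- Nearest point of `[p0, 0]`. -/
def clamp (p : ℝ) : ℝ := max d.p0 (min 0 p)

theorem continuous_clamp : Continuous d.clamp := by
  unfold clamp
  fun_prop

theorem clamp_mem (p : ℝ) : d.clamp p ∈ d.I :=
  ⟨le_max_left _ _, max_le d.p0_neg.le (min_le_left _ _)⟩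

theorem clamp_eq {p : ℝ} (hp : p ∈ d.I) : d.clamp p = p := by
  rw [clamp, min_eq_right hp.2, max_eq_right hp.1]

/-- Extending coefficients by `clamp` makes them continuous on the line, so that primitives have
two-sided derivatives even at the end points. -/
theorem continuous_comp_clamp {f : ℝ → ℝ} (hf : ContinuousOn f d.I) :
    Continuous fun p => f (d.clamp p) :=
  hf.comp_continuous d.continuous_clamp d.clamp_mem

theorem p0_mem_I : d.p0 ∈ d.I := ⟨le_rfl, d.p0_neg.le⟩

theorem Icc_subset_I {p : ℝ} (hp : p ∈ d.I) : Icc p 0 ⊆ d.I := fun _ hs => ⟨hp.1.trans hs.1, hs.2⟩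

theorem integral_congr_I {f g : ℝ → ℝ} {p q : ℝ} (hp : p ∈ d.I) (hq : q ∈ d.I)
    (h : ∀ s ∈ d.I, f s = g s) : ∫ s in p..q, f s = ∫ s in p..q, g s :=
  intervalIntegral.integral_congr fun s hs =>
    h s ⟨(le_min hp.1 hq.1).trans hs.1, hs.2.trans (max_le hp.2 hq.2)⟩

theorem D_eq {f : ℝ → ℝ} {f' p : ℝ} (hp : p ∈ d.I) (h : HasDerivWithinAt f f' d.I p) :
    d.D f p = f' := h.derivWithin (d.uniqueDiffOn_I p hp)

theorem hasDerivWithinAt_D {f : ℝ → ℝ} {n : ℕ} (hf : ContDiffOn ℝ (n + 1) f d.I) {p : ℝ}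
    (hp : p ∈ d.I) : HasDerivWithinAt f (d.D f p) d.I p :=
  (hf.differentiableOn (by positivity) p hp).hasDerivWithinAt

theorem contDiffOn_D {f : ℝ → ℝ} {n : ℕ} (hf : ContDiffOn ℝ (n + 1) f d.I) :
    ContDiffOn ℝ n (d.D f) d.I := hf.derivWithin d.uniqueDiffOn_I le_rfl

theorem contDiffOn_succ {f f' : ℝ → ℝ} {n : ℕ} (h : ∀ p ∈ d.I, HasDerivWithinAt f (f' p) d.I p)
    (hf' : ContDiffOn ℝ n f' d.I) : ContDiffOn ℝ (n + 1) f d.I := by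
  rw [contDiffOn_succ_iff_derivWithin d.uniqueDiffOn_I]
  exact ⟨fun p hp => (h p hp).differentiableWithinAt, by simp,
    hf'.congr fun p hp => d.D_eq hp (h p hp)⟩

theorem integral_eq_sub_I {f f' : ℝ → ℝ} (h : ∀ p ∈ d.I, HasDerivWithinAt f (f' p) d.I p)
    (hc : ContinuousOn f' d.I) {p q : ℝ} (hp : p ∈ d.I) (hq : q ∈ d.I) (hpq : p ≤ q) :
    ∫ s in p..q, f' s = f q - f p := by
  have hsub : Icc p q ⊆ d.I := Icc_subset_Icc hp.1 hq.2
  refine intervalIntegral.integral_eq_sub_of_hasDerivAt_of_le hpq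
    (fun s hs => ((h s (hsub hs)).continuousWithinAt).mono hsub)
    (fun s hs => (h s (hsub (Ioo_subset_Icc_self hs))).hasDerivAt
      (Icc_mem_nhds (hp.1.trans_lt hs.1) (hs.2.trans_le hq.2)))
    ((hc.mono hsub).intervalIntegrable_of_Icc hpq)

theorem eqOn_I_of_eqOn_Ioo {f g : ℝ → ℝ} (hf : ContinuousOn f d.I) (hg : ContinuousOn g d.I)
    (h : ∀ p ∈ Ioo d.p0 0, f p = g p) : ∀ p ∈ d.I, f p = g p := by
  have : EqOn f g (Ioo d.p0 0) := h
  exact this.of_subset_closure hf hg Ioo_subset_Icc_self (by rw [closure_Ioo d.p0_neg.ne]; rfl)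

/-! ### The coefficient functions -/

theorem continuousOn_D_rho : ContinuousOn (d.D d.rho) d.I :=
  (d.contDiffOn_D (n := 1) d.rho_class.1).continuousOn

/-- The coefficient `-g ρ'`, extended continuously to the line. -/
noncomputable def stiff (p : ℝ) : ℝ := -(d.g * d.D d.rho (d.clamp p))

theorem continuous_stiff : Continuous d.stiff :=
  ((d.continuous_comp_clamp d.continuousOn_D_rho).const_mul d.g).neg

theorem stiff_eq {p : ℝ} (hp : p ∈ d.I) : d.stiff p = -(d.g * d.D d.rho p) := by
  rw [stiff, d.clamp_eq hp]

theorem D_rho_nonpos (p : ℝ) : d.D d.rho p ≤ 0 := d.rho_antitone.derivWithin_nonpos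

theorem stiff_nonneg (p : ℝ) : 0 ≤ d.stiff p :=
  neg_nonneg.2 (mul_nonpos_of_nonneg_of_nonpos d.g_pos.le (d.D_rho_nonpos _))

theorem abs_D_rho_le {p : ℝ} (hp : p ∈ d.I) : |d.D d.rho p| ≤ d.rhoSup :=
  le_csSup (isCompact_Icc.image_of_continuousOn d.continuousOn_D_rho.abs).bddAbove
    (mem_image_of_mem _ hp)

theorem rhoSup_nonneg : 0 ≤ d.rhoSup := (abs_nonneg _).trans (d.abs_D_rho_le d.zero_mem_I)

theorem abs_stiff_le (p : ℝ) : |d.stiff p| ≤ d.g * d.rhoSup := by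
  rw [stiff, abs_neg, abs_mul, abs_of_pos d.g_pos]
  exact mul_le_mul_of_nonneg_left (d.abs_D_rho_le (d.clamp_mem p)) d.g_pos.le

/-- The function `p ↦ β(-p)`, extended continuously to the line. -/
def bern (p : ℝ) : ℝ := d.beta (-d.clamp p)

theorem neg_mem {p : ℝ} (hp : p ∈ d.I) : -p ∈ Icc (0 : ℝ) |d.p0| := by
  rw [abs_of_neg d.p0_neg]
  exact ⟨neg_nonneg.2 hp.2, neg_le_neg hp.1⟩

theorem continuous_bern : Continuous d.bern :=
  (d.beta_class.1.continuousOn.comp continuousOn_id.neg fun _ hp => d.neg_mem hp).comp_continuous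
    d.continuous_clamp d.clamp_mem

theorem bern_eq {p : ℝ} (hp : p ∈ d.I) : d.bern p = d.beta (-p) := by rw [bern, d.clamp_eq hp]

theorem B_eq {p : ℝ} (hp : p ∈ d.I) : d.B p = -∫ s in p..0, d.bern s := by
  rw [B, intervalIntegral.integral_symm, d.integral_congr_I hp d.zero_mem_I
    fun s hs => (d.bern_eq hs).symm]

variable {d}

/-- The right-hand side is lam + 2B(p), the squared speed in the absence of stratification. -/
theorem lt_of_mem_params {eps lam : ℝ} (hl : lam ∈ d.params eps) {p : ℝ} (hp : p ∈ d.I) :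
    eps < lam - 2 * ∫ s in p..0, d.bern s := by
  have hc : ContinuousOn d.B d.I :=
    (continuous_integral_to_zero d.continuous_bern).neg.continuousOn.congr fun p hp => d.B_eq hp
  have h1 : d.Bmin ≤ d.B p :=
    csInf_le (isCompact_Icc.image_of_continuousOn hc).bddBelow (mem_image_of_mem _ hp)
  have h2 : -2 * d.Bmin + eps < lam := hl
  rw [d.B_eq hp] at h1
  linarith

theorem eps_lt_of_mem_params {eps lam : ℝ} (hl : lam ∈ d.params eps) : eps < lam := by
  simpa using lt_of_mem_params hl d.zero_mem_I

/-- Since speeds are at least √eps, this is the smallness condition C R p0² ≤ 1/2 for all Volterra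
equations below; the factor exp |p0| ≥ 1 is dropped. -/
theorem IsThreshold.small {eps : ℝ} (h : d.IsThreshold eps) :
    (√eps ^ 3)⁻¹ * (d.g * d.rhoSup) * d.p0 ^ 2 ≤ 1 / 2 := by
  have h3 : eps ^ (3 / 2 : ℝ) = √eps ^ 3 := by
    rw [Real.sqrt_eq_rpow, ← Real.rpow_natCast, ← Real.rpow_mul h.1.le]
    norm_num
  have h1 := h.2.1
  have hpos : 0 < √eps ^ 3 := pow_pos (Real.sqrt_pos.2 h.1) 3
  have he : 1 ≤ Real.exp |d.p0| := Real.one_le_exp (abs_nonneg _)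
  have h0 : 0 ≤ 2 * d.g * d.rhoSup * d.p0 ^ 2 :=
    mul_nonneg (mul_nonneg (by linarith [d.g_pos]) d.rhoSup_nonneg) (sq_nonneg _)
  have h4 : 2 * d.g * d.rhoSup * d.p0 ^ 2 ≤ √eps ^ 3 := by
    rw [← h3]
    nlinarith
  rw [mul_assoc, inv_mul_le_iff₀ hpos]
  linarith

/-! ### Laminar flows as solutions of an integral equation -/

/-- The speed-like function `1 / H_p`, extended continuously to the line. -/
noncomputable def speed (d : WaveData) (lam p : ℝ) : ℝ := (d.D (d.H lam) (d.clamp p))⁻¹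

/-- The depth below the surface `H(0) - H(p)`, extended continuously to the line. -/
noncomputable def fall (d : WaveData) (lam p : ℝ) : ℝ := d.H lam 0 - d.H lam (d.clamp p)

theorem exists_isLaminar {eps lam : ℝ} (h : d.IsThreshold eps) (hl : lam ∈ d.params eps) :
    ∃ H Q, d.IsLaminar lam H Q := by
  have hs : 0 < √eps := Real.sqrt_pos.2 h.1
  -- The squared speed when x stands for ∫_p^0 (-gρ')(H(0) - H). The unknown `y` of the fixed point
  -- problem is H(0) - H.
  let A₀ : ℝ → ℝ → ℝ := fun p x => lam - 2 * (∫ s in p..0, d.bern s) + 2 * x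
  have hA₀ : Continuous fun x : ℝ × ℝ => A₀ x.1 x.2 :=
    (continuous_const.sub (((continuous_integral_to_zero d.continuous_bern).comp
      continuous_fst).const_mul 2)).add (continuous_snd.const_mul 2)
  have hle : ∀ z, √eps ≤ √(max z eps) := fun z => Real.sqrt_le_sqrt (le_max_right _ _)
  -- Truncation at eps makes the integrand globally Lipschitz in x.
  obtain ⟨y, hyc, hy⟩ := exists_volterra_fixedPoint (p0 := d.p0)
    (V := fun p x => (√(max (A₀ p x) eps))⁻¹) (r := d.stiff) (C := (√eps ^ 3)⁻¹)
    (R := d.g * d.rhoSup) d.p0_neg.le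
    ((Real.continuous_sqrt.comp (hA₀.max continuous_const)).inv₀
      fun x => (hs.trans_le (hle _)).ne')
    d.continuous_stiff
    (by
      intro s _ x z
      refine (abs_inv_sub_inv_le hs (hle _) (hle _)).trans ?_
      have h0 : ∀ z, 0 ≤ max z eps := fun z => h.1.le.trans (le_max_right _ _)
      rw [Real.sq_sqrt (h0 _), Real.sq_sqrt (h0 _)]
      have h1 : |max (A₀ s x) eps - max (A₀ s z) eps| ≤ |A₀ s x - A₀ s z| :=
        abs_max_sub_max_le_abs _ _ _
      have h2 : A₀ s x - A₀ s z = 2 * (x - z) := by simp only [A₀]; ring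
      rw [h2, abs_mul, abs_two] at h1
      have h3 : 0 < (√eps ^ 3)⁻¹ := by positivity
      nlinarith)
    (fun s _ => d.abs_stiff_le s) h.small
  have hy0 : ∀ p ∈ d.I, 0 ≤ y p := fun p hp => by
    rw [hy p hp]
    exact intervalIntegral.integral_nonneg hp.2 fun s _ => by positivity
  let A : ℝ → ℝ := fun p => A₀ p (∫ t in p..0, d.stiff t * y t)
  -- The truncation is inactive: stratification only increases the squared speed, as ρ is
  -- nonincreasing and y ≥ 0.
  have hAe : ∀ p ∈ d.I, eps < A p := fun p hp => by
    have h1 : 0 ≤ ∫ t in p..0, d.stiff t * y t :=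
      intervalIntegral.integral_nonneg hp.2 fun s hs =>
        mul_nonneg (d.stiff_nonneg s) (hy0 s (d.Icc_subset_I hp hs))
    have := lt_of_mem_params hl hp
    simp only [A, A₀]
    linarith
  have hAd : ∀ p, HasDerivAt A (2 * d.bern p - 2 * (d.stiff p * y p)) p := fun p => by
    have h1 := (hasDerivAt_integral_to_zero d.continuous_bern p).const_mul 2
    have h2 := (hasDerivAt_integral_to_zero (d.continuous_stiff.mul hyc) p).const_mul 2
    refine ((h1.const_sub lam).add h2).congr_deriv ?_
    simp only [Pi.mul_apply]
    ring
  have hAc : Continuous A := continuous_iff_continuousAt.2 fun p => (hAd p).continuousAt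
  let v : ℝ → ℝ := fun p => (√(max (A p) eps))⁻¹
  have hvc : Continuous v := (Real.continuous_sqrt.comp (hAc.max continuous_const)).inv₀
      fun x => (hs.trans_le (hle _)).ne'
  have hv : ∀ p ∈ d.I, v p = (√(A p))⁻¹ := fun p hp => by
    simp only [v]
    rw [max_eq_left (hAe p hp).le]
  let H : ℝ → ℝ := fun p => (∫ s in d.p0..0, v s) - ∫ s in p..0, v s
  have hHd : ∀ p, HasDerivAt H (v p) p := fun p =>
    ((hasDerivAt_integral_to_zero hvc p).const_sub _).congr_deriv (neg_neg _)
  have hDH : ∀ p ∈ d.I, d.D H p = v p := fun p hp => d.D_eq hp (hHd p).hasDerivWithinAt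
  have hH0 : ∀ p ∈ d.I, H p - H 0 = -y p := fun p hp => by
    simp only [H, hy p hp, intervalIntegral.integral_same]
    simp only [v, A]
    ring
  have hvd : ∀ p ∈ d.I,
      HasDerivWithinAt v (-(v p) ^ 3 * (d.bern p - d.stiff p * y p)) d.I p := fun p hp => by
    have hApos := h.1.trans (hAe p hp)
    have hsq := Real.sqrt_pos.2 hApos
    have h1 : HasDerivWithinAt (fun p => (√(A p))⁻¹)
        (-(v p) ^ 3 * (d.bern p - d.stiff p * y p)) d.I p := by
      refine (((hAd p).sqrt hApos.ne').inv hsq.ne').hasDerivWithinAt.congr_deriv ?_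
      rw [hv p hp]
      field_simp
    exact h1.congr hv (hv p hp)
  have hDHd : ∀ p ∈ d.I, d.D (d.D H) p = -(v p) ^ 3 * (d.bern p - d.stiff p * y p) :=
    fun p hp => d.D_eq hp ((hvd p hp).congr hDH (hDH p hp))
  have hA0 : A 0 = lam := by simp [A, A₀]
  have hlam : 0 < lam := h.1.trans (eps_lt_of_mem_params hl)
  have hD0 : d.D H 0 = (√lam)⁻¹ := by rw [hDH 0 d.zero_mem_I, hv 0 d.zero_mem_I, hA0]
  refine ⟨H, lam + 2 * d.g * d.rho 0 * H 0, ⟨?_, ?_, ?_, ?_, ?_, ?_⟩⟩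
  · refine d.contDiffOn_succ (n := 1) (fun p _ => (hHd p).hasDerivWithinAt) ?_
    refine d.contDiffOn_succ (n := 0) hvd (contDiffOn_zero.2 ?_)
    exact ((hvc.pow 3).neg.mul (d.continuous_bern.sub (d.continuous_stiff.mul hyc))).continuousOn
  · intro p hp
    rw [hDH p hp]
    exact inv_pos.2 (hs.trans_le (hle _))
  · intro p hp
    have hp' : p ∈ d.I := Ioo_subset_Icc_self hp
    rw [hDHd p hp', hDH p hp', hH0 p hp', d.stiff_eq hp', d.bern_eq hp']
    ring
  · rw [hD0, inv_pow, Real.sq_sqrt hlam.le]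
    field_simp
    ring
  · simp [H]
  · rw [hD0, Real.rpow_neg hlam.le, ← Real.sqrt_eq_rpow]

/-- `laminar` is a choice made separately for each `lam`; that it depends smoothly on `lam` is
recovered later from the integral equation. -/
theorem isLaminar {eps lam : ℝ} (h : d.IsThreshold eps) (hl : lam ∈ d.params eps) :
    d.IsLaminar lam (d.H lam) (d.Q lam) := by
  obtain ⟨H, Q, hHQ⟩ := exists_isLaminar h hl
  exact Classical.epsilon_spec (p := fun HQ : (ℝ → ℝ) × ℝ => d.IsLaminar lam HQ.1 HQ.2)
    ⟨(H, Q), hHQ⟩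

end WaveData

/-! ### Integral identities and bounds for the laminar flow. -/

namespace WaveData

variable {d : WaveData} {eps lam mu p : ℝ}

theorem hasDerivWithinAt_H (h : d.IsThreshold eps) (hl : lam ∈ d.params eps) (hp : p ∈ d.I) :
    HasDerivWithinAt (d.H lam) (d.D (d.H lam) p) d.I p :=
  d.hasDerivWithinAt_D (n := 1) (isLaminar h hl).contDiffOn hp

theorem hasDerivWithinAt_D_H (h : d.IsThreshold eps) (hl : lam ∈ d.params eps) (hp : p ∈ d.I) :
    HasDerivWithinAt (d.D (d.H lam)) (d.D (d.D (d.H lam)) p) d.I p :=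
  d.hasDerivWithinAt_D (n := 0) (d.contDiffOn_D (n := 1) (isLaminar h hl).contDiffOn) hp

theorem continuousOn_H (h : d.IsThreshold eps) (hl : lam ∈ d.params eps) :
    ContinuousOn (d.H lam) d.I := (isLaminar h hl).contDiffOn.continuousOn

theorem continuousOn_D_H (h : d.IsThreshold eps) (hl : lam ∈ d.params eps) :
    ContinuousOn (d.D (d.H lam)) d.I :=
  (d.contDiffOn_D (n := 1) (isLaminar h hl).contDiffOn).continuousOn

theorem speed_eq (hp : p ∈ d.I) : d.speed lam p = (d.D (d.H lam) p)⁻¹ := by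
  rw [speed, d.clamp_eq hp]

theorem fall_eq (hp : p ∈ d.I) : d.fall lam p = d.H lam 0 - d.H lam p := by
  rw [fall, d.clamp_eq hp]

theorem D_H_eq (hp : p ∈ d.I) : d.D (d.H lam) p = (d.speed lam p)⁻¹ := by
  rw [speed_eq hp, inv_inv]

theorem speed_pos (h : d.IsThreshold eps) (hl : lam ∈ d.params eps) (p : ℝ) :
    0 < d.speed lam p := inv_pos.2 ((isLaminar h hl).deriv_pos _ (d.clamp_mem p))

theorem continuous_speed (h : d.IsThreshold eps) (hl : lam ∈ d.params eps) :
    Continuous (d.speed lam) :=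
  (d.continuous_comp_clamp (continuousOn_D_H h hl)).inv₀
    fun p => ((isLaminar h hl).deriv_pos _ (d.clamp_mem p)).ne'

theorem continuous_fall (h : d.IsThreshold eps) (hl : lam ∈ d.params eps) :
    Continuous (d.fall lam) :=
  continuous_const.sub (d.continuous_comp_clamp (continuousOn_H h hl))

/-- The equation for `H` holds up to the boundary. -/
theorem D_D_H_eq (h : d.IsThreshold eps) (hl : lam ∈ d.params eps) (hp : p ∈ d.I) :
    d.D (d.D (d.H lam)) p = -(d.D (d.H lam) p) ^ 3 * (d.bern p - d.stiff p * d.fall lam p) := by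
  have hL := isLaminar h hl
  have h2 : ContinuousOn (d.D (d.D (d.H lam))) d.I :=
    (d.contDiffOn_D (n := 0) (d.contDiffOn_D (n := 1) hL.contDiffOn)).continuousOn
  refine d.eqOn_I_of_eqOn_Ioo h2 (((continuousOn_D_H h hl).fun_pow 3).fun_neg.fun_mul
    (d.continuous_bern.fun_sub (d.continuous_stiff.fun_mul (continuous_fall h hl))).continuousOn)
    (fun s hs => ?_) p hp
  have hs' : s ∈ d.I := Ioo_subset_Icc_self hs
  have := hL.ode s hs
  rw [d.bern_eq hs', d.stiff_eq hs', fall_eq hs']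
  linarith

theorem hasDerivWithinAt_speed (h : d.IsThreshold eps) (hl : lam ∈ d.params eps) (hp : p ∈ d.I) :
    HasDerivWithinAt (d.speed lam)
      ((d.bern p - d.stiff p * d.fall lam p) / d.speed lam p) d.I p := by
  have hpos := (isLaminar h hl).deriv_pos p hp
  refine (((hasDerivWithinAt_D_H h hl hp).inv hpos.ne').congr_deriv ?_).congr
    (fun s hs => speed_eq hs) (speed_eq hp)
  rw [D_D_H_eq h hl hp, speed_eq hp]
  field_simp

theorem fall_eq_integral (h : d.IsThreshold eps) (hl : lam ∈ d.params eps) (hp : p ∈ d.I) :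
    d.fall lam p = ∫ s in p..0, (d.speed lam s)⁻¹ := by
  rw [fall_eq hp, ← d.integral_eq_sub_I (fun s hs => hasDerivWithinAt_H h hl hs)
    (continuousOn_D_H h hl) hp d.zero_mem_I hp.2]
  exact d.integral_congr_I hp d.zero_mem_I fun s hs => D_H_eq hs

theorem lam_pos (h : d.IsThreshold eps) (hl : lam ∈ d.params eps) : 0 < lam :=
  h.1.trans (eps_lt_of_mem_params hl)

theorem speed_zero (h : d.IsThreshold eps) (hl : lam ∈ d.params eps) :
    d.speed lam 0 = √lam := by
  rw [speed_eq d.zero_mem_I, (isLaminar h hl).param, Real.rpow_neg (lam_pos h hl).le, inv_inv,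
    Real.sqrt_eq_rpow]

/-- Bernoulli's law: the derivative of the squared speed is twice `bern - stiff * fall`, with value
`lam` at the top. -/
theorem speed_sq (h : d.IsThreshold eps) (hl : lam ∈ d.params eps) (hp : p ∈ d.I) :
    d.speed lam p ^ 2 = lam - 2 * (∫ s in p..0, d.bern s)
      + 2 * ∫ s in p..0, d.stiff s * d.fall lam s := by
  have hc := d.continuous_stiff.fun_mul (continuous_fall h hl)
  have hd : ∀ s ∈ d.I, HasDerivWithinAt (fun s => d.speed lam s ^ 2)
      (2 * d.bern s - 2 * (d.stiff s * d.fall lam s)) d.I s := fun s hs => by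
    refine ((hasDerivWithinAt_speed h hl hs).pow 2).congr_deriv ?_
    have := speed_pos h hl s
    field_simp
    ring
  have := d.integral_eq_sub_I hd
    ((d.continuous_bern.const_mul 2).fun_sub (hc.const_mul 2)).continuousOn hp d.zero_mem_I hp.2
  rw [intervalIntegral.integral_sub ((d.continuous_bern.const_mul 2).intervalIntegrable _ _)
    ((hc.const_mul 2).intervalIntegrable _ _), intervalIntegral.integral_const_mul,
    intervalIntegral.integral_const_mul, speed_zero h hl, Real.sq_sqrt (lam_pos h hl).le] at this
  linarith

theorem fall_nonneg (h : d.IsThreshold eps) (hl : lam ∈ d.params eps) (hp : p ∈ d.I) :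
    0 ≤ d.fall lam p := by
  rw [fall_eq_integral h hl hp]
  exact intervalIntegral.integral_nonneg hp.2 fun s _ => (inv_pos.2 (speed_pos h hl s)).le

theorem sqrt_eps_le_speed (h : d.IsThreshold eps) (hl : lam ∈ d.params eps) (p : ℝ) :
    √eps ≤ d.speed lam p := by
  have h0 : d.speed lam p = d.speed lam (d.clamp p) := by
    rw [speed, speed, d.clamp_eq (d.clamp_mem p)]
  rw [h0]
  have hp := d.clamp_mem p
  refine Real.sqrt_le_iff.2 ⟨(speed_pos h hl _).le, ?_⟩
  have h1 : 0 ≤ ∫ s in d.clamp p..0, d.stiff s * d.fall lam s :=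
    intervalIntegral.integral_nonneg hp.2 fun s hs =>
      mul_nonneg (d.stiff_nonneg s) (fall_nonneg h hl (d.Icc_subset_I hp hs))
  rw [speed_sq h hl hp]
  have := lt_of_mem_params hl hp
  linarith

theorem inv_speed_cube_le (h : d.IsThreshold eps) (hl : lam ∈ d.params eps) (p : ℝ) :
    |(d.speed lam p ^ 3)⁻¹| ≤ (√eps ^ 3)⁻¹ := by
  have hs : 0 < √eps := Real.sqrt_pos.2 h.1
  have := speed_pos h hl p
  rw [abs_of_pos (by positivity)]
  exact inv_anti₀ (by positivity) (pow_le_pow_left₀ hs.le (sqrt_eps_le_speed h hl p) 3)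

theorem continuous_inv_speed_cube (h : d.IsThreshold eps) (hl : lam ∈ d.params eps) :
    Continuous fun p => (d.speed lam p ^ 3)⁻¹ :=
  ((continuous_speed h hl).pow 3).inv₀ fun p => (pow_pos (speed_pos h hl p) 3).ne'

theorem Q_eq (h : d.IsThreshold eps) (hl : lam ∈ d.params eps) :
    d.Q lam = lam + 2 * d.g * d.rho 0 * d.fall lam d.p0 := by
  have h1 := (isLaminar h hl).top
  rw [D_H_eq d.zero_mem_I, speed_zero h hl, inv_pow, Real.sq_sqrt (lam_pos h hl).le] at h1
  have := lam_pos h hl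
  rw [fall_eq d.p0_mem_I, (isLaminar h hl).bottom, sub_zero]
  field_simp at h1
  linarith

/-! ### Dependence on the parameter -/

/-- `k` solves the linear equation satisfied by the derivative of `Y` in the parameter. -/
structure IsVariation (d : WaveData) (lam : ℝ) (k : ℝ → ℝ) : Prop where
  continuous : Continuous k
  eq : ∀ p ∈ d.I, k p = ∫ s in p..0, (d.speed lam s ^ 3)⁻¹ *
    (1 / 2 - ∫ t in s..0, d.stiff t * k t)

theorem exists_isVariation (h : d.IsThreshold eps) (hl : lam ∈ d.params eps) :
    ∃ k, d.IsVariation lam k := by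
  have hs : 0 < √eps := Real.sqrt_pos.2 h.1
  obtain ⟨k, hk, hk'⟩ := exists_volterra_fixedPoint (p0 := d.p0)
    (V := fun p x => (d.speed lam p ^ 3)⁻¹ * (1 / 2 - x)) (r := d.stiff) (C := (√eps ^ 3)⁻¹)
    (R := d.g * d.rhoSup) d.p0_neg.le
    (((continuous_inv_speed_cube h hl).comp continuous_fst).mul
      (continuous_const.fun_sub continuous_snd))
    d.continuous_stiff
    (by
      intro s _ x y
      rw [← mul_sub, abs_mul, sub_sub_sub_cancel_left, abs_sub_comm]
      exact mul_le_mul_of_nonneg_right (inv_speed_cube_le h hl s) (abs_nonneg _))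
    (fun s _ => d.abs_stiff_le s) h.small
  exact ⟨k, hk, hk'⟩

/-- `k` as solution of a Volterra equation. -/
theorem IsVariation.eq_volterra (h : d.IsThreshold eps) (hl : lam ∈ d.params eps) {k : ℝ → ℝ}
    (hk : d.IsVariation lam k) (hp : p ∈ d.I) :
    k p = (∫ s in p..0, (d.speed lam s ^ 3)⁻¹ * (1 / 2))
      - volterra (fun s => (d.speed lam s ^ 3)⁻¹) d.stiff k p := by
  have hc := continuous_inv_speed_cube h hl
  have hi := continuous_integral_to_zero (d.continuous_stiff.fun_mul hk.continuous)
  rw [hk.eq p hp, volterra, ← intervalIntegral.integral_sub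
    ((hc.fun_mul continuous_const).intervalIntegrable _ _) ((hc.fun_mul hi).intervalIntegrable _ _)]
  simp only [mul_sub]

theorem IsVariation.lower_bound (h : d.IsThreshold eps) (hl : lam ∈ d.params eps) {k : ℝ → ℝ}
    (hk : d.IsVariation lam k) :
    ∫ s in d.p0..0, (d.speed lam s ^ 3)⁻¹ ≤ 3 * k d.p0 := by
  have := volterra_solution_lower_bound d.p0_neg.le (fun s _ => inv_speed_cube_le h hl s)
    (fun s _ => d.abs_stiff_le s) h.small hk.continuous.continuousOn
    ((continuous_inv_speed_cube h hl).fun_mul continuous_const)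
    (fun s _ => by have := speed_pos h hl s; positivity)
    (fun p hp => hk.eq_volterra h hl hp)
  rw [intervalIntegral.integral_mul_const] at this
  linarith

/-- The second order remainder of `x ↦ x^{-1/2}` in terms of square roots. -/
noncomputable def invSqrtRem (u v : ℝ) : ℝ := (u - v) ^ 2 * (u + 2 * v) / (2 * u * v ^ 3)

/-- The right-hand side is the Taylor remainder of x^(-1/2) at v², evaluated at u². The factored
form in the definition makes its nonnegativity, that is convexity, visible. -/
theorem invSqrtRem_eq {u v : ℝ} (hu : 0 < u) (hv : 0 < v) :
    invSqrtRem u v = u⁻¹ - v⁻¹ + (v ^ 3)⁻¹ * ((u ^ 2 - v ^ 2) / 2) := by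
  rw [invSqrtRem]
  field_simp
  ring

theorem invSqrtRem_le {u v s : ℝ} (hs : 0 < s) (hu : s ≤ u) (hv : s ≤ v) :
    invSqrtRem u v ≤ (s ^ 5)⁻¹ * (u ^ 2 - v ^ 2) ^ 2 := by
  have hu0 := hs.trans_le hu
  have hv0 := hs.trans_le hv
  have h1 : invSqrtRem u v
      = ((2 * v ^ 3)⁻¹ + (u * v ^ 2)⁻¹) * ((u + v) ^ 2)⁻¹ * (u ^ 2 - v ^ 2) ^ 2 := by
    rw [invSqrtRem]
    field_simp
    ring
  rw [h1]
  refine mul_le_mul_of_nonneg_right ?_ (sq_nonneg _)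
  have h2 : (2 * v ^ 3)⁻¹ ≤ (2 * s ^ 3)⁻¹ := by gcongr
  have h3 : (u * v ^ 2)⁻¹ ≤ (s * s ^ 2)⁻¹ := by gcongr
  have h4 : ((u + v) ^ 2)⁻¹ ≤ ((s + s) ^ 2)⁻¹ := by gcongr
  calc _ ≤ ((2 * s ^ 3)⁻¹ + (s * s ^ 2)⁻¹) * ((s + s) ^ 2)⁻¹ := by gcongr
    _ = 3 / 8 * (s ^ 5)⁻¹ := by
      field_simp
      norm_num
    _ ≤ (s ^ 5)⁻¹ := by
      have : 0 < (s ^ 5)⁻¹ := by positivity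
      linarith

theorem continuous_invSqrtRem_speed (h : d.IsThreshold eps) (hl : lam ∈ d.params eps)
    (hm : mu ∈ d.params eps) :
    Continuous fun s => invSqrtRem (d.speed mu s) (d.speed lam s) := by
  have hum := continuous_speed h hm
  have hul := continuous_speed h hl
  refine (((hum.sub hul).pow 2).mul (hum.add (hul.const_mul 2))).div
    ((hum.const_mul 2).mul (hul.pow 3)) fun s => ?_
  have := speed_pos h hm s
  have := speed_pos h hl s
  positivity

/-- Expand 1/u at the squared speed for `lam`. The squared speeds differ by mu - lam plus an
integral of the difference of `fall`, and the equation for `k` absorbs the term mu - lam; only the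
Taylor remainder is left as inhomogeneity. -/
theorem remainder_eq_volterra (h : d.IsThreshold eps) (hl : lam ∈ d.params eps)
    (hm : mu ∈ d.params eps) {k : ℝ → ℝ} (hk : d.IsVariation lam k) (hp : p ∈ d.I) :
    d.fall mu p - d.fall lam p + (mu - lam) * k p
      = (∫ s in p..0, invSqrtRem (d.speed mu s) (d.speed lam s))
        - volterra (fun s => (d.speed lam s ^ 3)⁻¹) d.stiff
          (fun s => d.fall mu s - d.fall lam s + (mu - lam) * k s) p := by
  have hfm := continuous_fall h hm
  have hfl := continuous_fall h hl
  have hr := d.continuous_stiff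
  have hc := continuous_inv_speed_cube h hl
  have hum : Continuous fun s => (d.speed mu s)⁻¹ :=
    (continuous_speed h hm).inv₀ fun s => (speed_pos h hm s).ne'
  have hul : Continuous fun s => (d.speed lam s)⁻¹ :=
    (continuous_speed h hl).inv₀ fun s => (speed_pos h hl s).ne'
  have hkc := hk.continuous
  have hik := continuous_integral_to_zero (hr.fun_mul hkc)
  have he : Continuous fun s => d.fall mu s - d.fall lam s + (mu - lam) * k s :=
    (hfm.fun_sub hfl).fun_add (hkc.const_mul _)
  have hie := continuous_integral_to_zero (hr.fun_mul he)
  have hrem := continuous_invSqrtRem_speed h hl hm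
  rw [volterra, ← intervalIntegral.integral_sub (hrem.intervalIntegrable _ _)
    ((hc.fun_mul hie).intervalIntegrable _ _), fall_eq_integral h hm hp, fall_eq_integral h hl hp,
    hk.eq p hp, ← intervalIntegral.integral_sub (hum.intervalIntegrable _ _)
    (hul.intervalIntegrable _ _), ← intervalIntegral.integral_const_mul,
    ← intervalIntegral.integral_add ((hum.fun_sub hul).intervalIntegrable _ _)
    (((hc.fun_mul (continuous_const.fun_sub hik)).const_mul _).intervalIntegrable _ _)]
  refine d.integral_congr_I hp d.zero_mem_I fun s hs => ?_
  have hsplit : (∫ t in s..0, d.stiff t * (d.fall mu t - d.fall lam t + (mu - lam) * k t))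
      = (∫ t in s..0, d.stiff t * d.fall mu t) - (∫ t in s..0, d.stiff t * d.fall lam t)
        + (mu - lam) * ∫ t in s..0, d.stiff t * k t := by
    rw [← intervalIntegral.integral_sub ((hr.fun_mul hfm).intervalIntegrable _ _)
      ((hr.fun_mul hfl).intervalIntegrable _ _), ← intervalIntegral.integral_const_mul,
      ← intervalIntegral.integral_add (((hr.fun_mul hfm).fun_sub (hr.fun_mul hfl)).intervalIntegrable _ _)
      (((hr.fun_mul hkc).const_mul _).intervalIntegrable _ _)]
    refine intervalIntegral.integral_congr fun t _ => ?_
    ring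
  rw [invSqrtRem_eq (speed_pos h hm s) (speed_pos h hl s), speed_sq h hm hs, speed_sq h hl hs,
    hsplit]
  ring

end WaveData

namespace WaveData

variable {d : WaveData} {eps lam mu p : ℝ}

theorem remainder_pos (h : d.IsThreshold eps) (hl : lam ∈ d.params eps) (hm : mu ∈ d.params eps)
    (hne : mu ≠ lam) {k : ℝ → ℝ} (hk : d.IsVariation lam k) :
    0 < d.fall mu d.p0 - d.fall lam d.p0 + (mu - lam) * k d.p0 := by
  have hf0 : ∀ s, 0 ≤ invSqrtRem (d.speed mu s) (d.speed lam s) := fun s => by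
    have := speed_pos h hm s
    have := speed_pos h hl s
    unfold invSqrtRem
    positivity
  have hc := continuous_invSqrtRem_speed h hl hm
  have h1 := volterra_solution_lower_bound d.p0_neg.le (fun s _ => inv_speed_cube_le h hl s)
    (fun s _ => d.abs_stiff_le s) h.small
    (((continuous_fall h hm).sub (continuous_fall h hl)).add
      (hk.continuous.const_mul _)).continuousOn hc
    (fun s _ => hf0 s) (fun p hp => remainder_eq_volterra h hl hm hk hp)
  refine lt_of_lt_of_le (mul_pos (by norm_num) ?_) h1
  refine intervalIntegral.integral_pos d.p0_neg hc.continuousOn (fun s _ => hf0 s)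
    ⟨0, d.zero_mem_I, ?_⟩
  -- Strictness comes from the top, where the speeds √mu and √lam differ.
  have h2 : d.speed mu 0 - d.speed lam 0 ≠ 0 := by
    rw [speed_zero h hm, speed_zero h hl, sub_ne_zero]
    exact fun h3 => hne ((Real.sqrt_inj (lam_pos h hm).le (lam_pos h hl).le).1 h3)
  have := speed_pos h hm 0
  have := speed_pos h hl 0
  unfold invSqrtRem
  positivity

/-- The squared speeds and `fall` control each other; the small kernel lets the maximal difference
`S` of `fall` be absorbed. -/
theorem abs_speed_sq_sub_le (h : d.IsThreshold eps) (hl : lam ∈ d.params eps)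
    (hm : mu ∈ d.params eps) (hp : p ∈ d.I) :
    |d.speed mu p ^ 2 - d.speed lam p ^ 2| ≤ 2 * |mu - lam| := by
  have hs : 0 < √eps := Real.sqrt_pos.2 h.1
  have hfm := continuous_fall h hm
  have hfl := continuous_fall h hl
  have hr := d.continuous_stiff
  have hR0 : 0 ≤ d.g * d.rhoSup := mul_nonneg d.g_pos.le d.rhoSup_nonneg
  set C := (√eps ^ 3)⁻¹ with hC
  have hC0 : 0 < C := by positivity
  obtain ⟨m, hmI, hmax⟩ := isCompact_Icc.exists_isMaxOn (nonempty_Icc.2 d.p0_neg.le)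
    (hfm.sub hfl).abs.continuousOn
  set S := |d.fall mu m - d.fall lam m| with hS
  have hS0 : 0 ≤ S := abs_nonneg _
  have hmax' : ∀ s ∈ d.I, |d.fall mu s - d.fall lam s| ≤ S := fun s hs => hmax hs
  have hsq : ∀ s ∈ d.I, |d.speed mu s ^ 2 - d.speed lam s ^ 2|
      ≤ |mu - lam| + 2 * (d.g * d.rhoSup * S * -d.p0) := by
    intro s hs
    have h1 : d.speed mu s ^ 2 - d.speed lam s ^ 2
        = (mu - lam) + 2 * ∫ t in s..0, d.stiff t * (d.fall mu t - d.fall lam t) := by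
      have : ∫ t in s..0, d.stiff t * (d.fall mu t - d.fall lam t)
          = (∫ t in s..0, d.stiff t * d.fall mu t) - ∫ t in s..0, d.stiff t * d.fall lam t := by
        rw [← intervalIntegral.integral_sub ((hr.fun_mul hfm).intervalIntegrable _ _)
          ((hr.fun_mul hfl).intervalIntegrable _ _)]
        simp only [mul_sub]
      rw [speed_sq h hm hs, speed_sq h hl hs, this]
      ring
    have h2 : |∫ t in s..0, d.stiff t * (d.fall mu t - d.fall lam t)|
        ≤ d.g * d.rhoSup * S * -s := abs_integral_to_zero_le hs.2 fun t ht => by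
      rw [abs_mul]
      exact mul_le_mul (d.abs_stiff_le t) (hmax' t (d.Icc_subset_I hs ht)) (abs_nonneg _) hR0
    have h3 : d.g * d.rhoSup * S * -s ≤ d.g * d.rhoSup * S * -d.p0 :=
      mul_le_mul_of_nonneg_left (neg_le_neg hs.1) (by positivity)
    rw [h1]
    refine (abs_add_le _ _).trans ?_
    rw [abs_mul, abs_two]
    linarith
  have hsmall : C * (d.g * d.rhoSup) * d.p0 ^ 2 ≤ 1 / 2 := h.small
  have h4 : S ≤ C / 2 * (|mu - lam| + 2 * (d.g * d.rhoSup * S * -d.p0)) * -m := by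
    have hi : ∀ {nu}, nu ∈ d.params eps → Continuous fun s => (d.speed nu s)⁻¹ := fun hn =>
      (continuous_speed h hn).inv₀ fun s => (speed_pos h hn s).ne'
    conv_lhs => rw [hS]
    rw [fall_eq_integral h hm hmI, fall_eq_integral h hl hmI,
      ← intervalIntegral.integral_sub ((hi hm).intervalIntegrable _ _)
      ((hi hl).intervalIntegrable _ _)]
    refine abs_integral_to_zero_le hmI.2 fun s hs' => ?_
    refine (abs_inv_sub_inv_le hs (sqrt_eps_le_speed h hm s) (sqrt_eps_le_speed h hl s)).trans ?_
    exact mul_le_mul_of_nonneg_left (hsq s (d.Icc_subset_I hmI hs')) (by positivity)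
  have hp0 := d.p0_neg
  have h5 : S ≤ C / 2 * (|mu - lam| + 2 * (d.g * d.rhoSup * S * -d.p0)) * -d.p0 := by
    refine h4.trans (mul_le_mul_of_nonneg_left (neg_le_neg hmI.1) ?_)
    have := mul_nonneg (mul_nonneg hR0 hS0) (neg_nonneg.2 hp0.le)
    positivity
  have h6 : S ≤ C * |mu - lam| * -d.p0 := by
    have := mul_le_mul_of_nonneg_right hsmall hS0
    nlinarith
  have h7 : 2 * (d.g * d.rhoSup * S * -d.p0) ≤ |mu - lam| := by
    have := mul_le_mul_of_nonneg_left h6 (mul_nonneg hR0 (neg_nonneg.2 hp0.le))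
    have := mul_le_mul_of_nonneg_right hsmall (abs_nonneg (mu - lam))
    nlinarith
  linarith [hsq p hp]

/-- The quadratic bound that gives differentiability in `lam`: 4/3 is the a priori constant of the
Volterra equation, 4 the square of the Lipschitz constant of the squared speed, and √eps⁻⁵ comes
from `invSqrtRem_le`. -/
theorem abs_remainder_le (h : d.IsThreshold eps) (hl : lam ∈ d.params eps)
    (hm : mu ∈ d.params eps) {k : ℝ → ℝ} (hk : d.IsVariation lam k) :
    |d.fall mu d.p0 - d.fall lam d.p0 + (mu - lam) * k d.p0|
      ≤ 4 / 3 * ((√eps ^ 5)⁻¹ * 4 * -d.p0) * (mu - lam) ^ 2 := by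
  have hs : 0 < √eps := Real.sqrt_pos.2 h.1
  have hF : ∀ p ∈ Icc d.p0 0, |∫ s in p..0, invSqrtRem (d.speed mu s) (d.speed lam s)|
      ≤ (√eps ^ 5)⁻¹ * (4 * (mu - lam) ^ 2) * -d.p0 := fun p hp => by
    refine (abs_integral_to_zero_le hp.2 (C := (√eps ^ 5)⁻¹ * (4 * (mu - lam) ^ 2))
      fun s hs' => ?_).trans (mul_le_mul_of_nonneg_left (neg_le_neg hp.1) (by positivity))
    have h1 := speed_pos h hm s
    have h2 := speed_pos h hl s
    rw [abs_of_nonneg (by unfold invSqrtRem; positivity)]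
    refine (invSqrtRem_le hs (sqrt_eps_le_speed h hm s) (sqrt_eps_le_speed h hl s)).trans
      (mul_le_mul_of_nonneg_left ?_ (by positivity))
    have := abs_speed_sq_sub_le h hl hm (d.Icc_subset_I hp hs')
    have := pow_le_pow_left₀ (abs_nonneg _) this 2
    rw [sq_abs, mul_pow, sq_abs] at this
    linarith
  have := volterra_solution_abs_le d.p0_neg.le (fun s _ => inv_speed_cube_le h hl s)
    (fun s _ => d.abs_stiff_le s) h.small
    (((continuous_fall h hm).sub (continuous_fall h hl)).add
      (hk.continuous.const_mul _)).continuousOn hF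
    (fun p hp => remainder_eq_volterra h hl hm hk hp) d.p0 d.p0_mem_I
  refine this.trans (le_of_eq ?_)
  ring

theorem params_mem_nhds (hl : lam ∈ d.params eps) : d.params eps ∈ nhds lam :=
  isOpen_Ioi.mem_nhds hl

theorem hasDerivAt_fall (h : d.IsThreshold eps) (hl : lam ∈ d.params eps) {k : ℝ → ℝ}
    (hk : d.IsVariation lam k) : HasDerivAt (fun mu => d.fall mu d.p0) (-k d.p0) lam := by
  rw [hasDerivAt_iff_isLittleO]
  have hO : (fun mu => d.fall mu d.p0 - d.fall lam d.p0 - (mu - lam) • -k d.p0)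
      =O[nhds lam] fun mu => (mu - lam) ^ 2 := by
    refine Asymptotics.IsBigO.of_bound (4 / 3 * ((√eps ^ 5)⁻¹ * 4 * -d.p0)) ?_
    filter_upwards [params_mem_nhds hl] with mu hm
    have := abs_remainder_le h hl hm hk
    rw [Real.norm_eq_abs, Real.norm_eq_abs, abs_of_nonneg (sq_nonneg (mu - lam)), smul_eq_mul,
      mul_neg, sub_neg_eq_add]
    exact this
  refine hO.trans_isLittleO ?_
  have := (Asymptotics.isLittleO_pow_id (𝕜 := ℝ) one_lt_two).comp_tendsto
    (show Filter.Tendsto (fun mu => mu - lam) (nhds lam) (nhds 0) by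
      have : Filter.Tendsto (fun mu => mu - lam) (nhds lam) (nhds (lam - lam)) :=
        (continuous_id.sub continuous_const).tendsto lam
      rwa [sub_self] at this)
  exact this

theorem Ydot_eq (h : d.IsThreshold eps) (hl : lam ∈ d.params eps) {k : ℝ → ℝ}
    (hk : d.IsVariation lam k) : d.Ydot lam d.p0 = k d.p0 := by
  have : HasDerivAt (fun mu => d.Y mu d.p0) (k d.p0) lam := by
    refine ((hasDerivAt_fall h hl hk).neg.congr_deriv (neg_neg _)).congr_of_eventuallyEq
      (Filter.Eventually.of_forall fun mu => ?_)
    simp only [Y, Pi.neg_apply, fall_eq d.p0_mem_I, neg_sub]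
  exact this.deriv

theorem hasDerivAt_Q (h : d.IsThreshold eps) (hl : lam ∈ d.params eps) {k : ℝ → ℝ}
    (hk : d.IsVariation lam k) :
    HasDerivAt d.Q (1 - 2 * d.g * d.rho 0 * k d.p0) lam := by
  have h1 := (hasDerivAt_id lam).add ((hasDerivAt_fall h hl hk).const_mul (2 * d.g * d.rho 0))
  refine (h1.congr_deriv (by ring)).congr_of_eventuallyEq ?_
  filter_upwards [params_mem_nhds hl] with mu hm using Q_eq h hm

theorem rho_zero_pos (d : WaveData) : 0 < d.rho 0 := d.rho_pos 0 d.zero_mem_I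

/-- `Q` lies strictly above its tangents. -/
theorem tangent_lt_Q (h : d.IsThreshold eps) (hl : lam ∈ d.params eps) (hm : mu ∈ d.params eps)
    (hne : mu ≠ lam) {k : ℝ → ℝ} (hk : d.IsVariation lam k) :
    d.Q lam + (1 - 2 * d.g * d.rho 0 * k d.p0) * (mu - lam) < d.Q mu := by
  have h1 := remainder_pos h hl hm hne hk
  rw [Q_eq h hl, Q_eq h hm]
  have := mul_pos (mul_pos (mul_pos two_pos d.g_pos) d.rho_zero_pos) h1
  nlinarith

theorem isLambdaZero_iff (h : d.IsThreshold eps) (hl : lam ∈ d.params eps) {k : ℝ → ℝ}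
    (hk : d.IsVariation lam k) :
    d.IsLambdaZero eps lam ↔ 2 * d.g * d.rho 0 * k d.p0 = 1 := by
  constructor
  · intro h0
    have hmin : IsLocalMin d.Q lam := by
      filter_upwards [params_mem_nhds hl] with mu hm
      by_cases hne : mu = lam
      · rw [hne]
      · exact (h0.2 mu hm hne).le
    have := hmin.hasDerivAt_eq_zero (hasDerivAt_Q h hl hk)
    linarith
  · intro h1
    refine ⟨hl, fun mu hm hne => ?_⟩
    have := tangent_lt_Q h hl hm hne hk
    rw [h1] at this
    linarith

/-- Past the minimum point, `Q` has positive slope. -/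
theorem IsLambdaZero.slope_pos (h : d.IsThreshold eps) (hl : lam ∈ d.params eps) {k : ℝ → ℝ}
    (hk : d.IsVariation lam k) (h0 : d.IsLambdaZero eps mu) (hlt : mu < lam) :
    2 * d.g * d.rho 0 * k d.p0 < 1 := by
  -- The tangent at `lam`, evaluated at the minimum point, lies below the minimum and hence below
  -- Q(lam).
  have h1 := tangent_lt_Q h hl h0.1 hlt.ne hk
  have h2 := h0.2 lam hl hlt.ne'
  nlinarith

end WaveData

namespace WaveData

variable {d : WaveData} {eps lam mu p : ℝ}

/-! ### Mode solutions as solutions of a first order system -/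

/-- `(M, N)` solves the first order system equivalent to the mode `n` problem. -/
structure IsModePair (d : WaveData) (lam : ℝ) (n : ℕ) (M N : ℝ → ℝ) : Prop where
  deriv_fst : ∀ p ∈ d.I, HasDerivWithinAt M ((d.speed lam p ^ 3)⁻¹ * N p) d.I p
  deriv_snd : ∀ p ∈ d.I, HasDerivWithinAt N ((n : ℝ) ^ 2 * d.speed lam p * M p
    - d.stiff p * (M p - if n = 0 then M 0 else 0)) d.I p
  bottom : M d.p0 = 0
  top : N 0 = ((n : ℝ) ^ 2 * d.sigma + d.g * d.rho 0) * M 0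

namespace IsModePair

variable {n : ℕ} {M N : ℝ → ℝ}

theorem continuousOn_fst (hp : d.IsModePair lam n M N) : ContinuousOn M d.I := fun p h =>
  (hp.deriv_fst p h).continuousWithinAt

theorem continuousOn_snd (hp : d.IsModePair lam n M N) : ContinuousOn N d.I := fun p h =>
  (hp.deriv_snd p h).continuousWithinAt

theorem smul (hp : d.IsModePair lam n M N) (c : ℝ) :
    d.IsModePair lam n (fun p => c * M p) (fun p => c * N p) where
  deriv_fst p h := ((hp.deriv_fst p h).const_mul c).congr_deriv (by ring)
  deriv_snd p h := ((hp.deriv_snd p h).const_mul c).congr_deriv (by split_ifs <;> ring)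
  bottom := by rw [hp.bottom, mul_zero]
  top := by rw [hp.top]; ring

end IsModePair

theorem speed_zero_cube (h : d.IsThreshold eps) (hl : lam ∈ d.params eps) :
    d.speed lam 0 ^ 3 = lam ^ (3 / 2 : ℝ) := by
  rw [speed_zero h hl, Real.sqrt_eq_rpow, ← Real.rpow_natCast, ← Real.rpow_mul (lam_pos h hl).le]
  norm_num

theorem contDiffOn_D_H (h : d.IsThreshold eps) (hl : lam ∈ d.params eps) :
    ContDiffOn ℝ 1 (d.D (d.H lam)) d.I := d.contDiffOn_D (n := 1) (isLaminar h hl).contDiffOn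

theorem IsModeSolution.isModePair (h : d.IsThreshold eps) (hl : lam ∈ d.params eps) {n : ℕ}
    {M : ℝ → ℝ} (hM : d.IsModeSolution lam n M) :
    d.IsModePair lam n M (fun p => d.speed lam p ^ 3 * d.D M p) where
  deriv_fst p hp := by
    refine (d.hasDerivWithinAt_D (n := 1) hM.contDiffOn hp).congr_deriv ?_
    have := speed_pos h hl p
    field_simp
  deriv_snd p hp := by
    have hc1 : ContDiffOn ℝ 1 (fun p => (d.D (d.H lam) p ^ 3)⁻¹ * d.D M p) d.I :=
      (((contDiffOn_D_H h hl).pow 3).inv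
        fun s hs => (pow_pos ((isLaminar h hl).deriv_pos s hs) 3).ne').mul
        (d.contDiffOn_D (n := 1) hM.contDiffOn)
    have hMc := hM.contDiffOn.continuousOn
    have heq : ∀ s ∈ d.I, d.D (fun p => (d.D (d.H lam) p ^ 3)⁻¹ * d.D M p) s
        = (n : ℝ) ^ 2 * d.speed lam s * M s - d.stiff s * (M s - if n = 0 then M 0 else 0) := by
      -- The equation is given on the open interval only; continuity carries it to the end points.
      refine d.eqOn_I_of_eqOn_Ioo (d.contDiffOn_D (n := 0) hc1).continuousOn
        (((continuous_const.fun_mul (continuous_speed h hl)).continuousOn.fun_mul hMc).fun_sub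
          (d.continuous_stiff.continuousOn.fun_mul (hMc.fun_sub continuousOn_const)))
        fun s hs => ?_
      have hs' : s ∈ d.I := Ioo_subset_Icc_self hs
      rw [hM.ode s hs, speed_eq hs', d.stiff_eq hs']
      ring
    have hcg : ∀ s ∈ d.I, d.speed lam s ^ 3 * d.D M s = (d.D (d.H lam) s ^ 3)⁻¹ * d.D M s :=
      fun s hs => by rw [speed_eq hs, inv_pow]
    rw [← heq p hp]
    exact (d.hasDerivWithinAt_D (n := 0) hc1 hp).congr hcg (hcg p hp)
  bottom := hM.bottom
  top := by rw [speed_zero_cube h hl, hM.top]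

theorem IsModePair.isModeSolution (h : d.IsThreshold eps) (hl : lam ∈ d.params eps) {n : ℕ}
    {M N : ℝ → ℝ} (hM : d.IsModePair lam n M N) : d.IsModeSolution lam n M := by
  have hDM : ∀ p ∈ d.I, d.D M p = (d.speed lam p ^ 3)⁻¹ * N p := fun p hp =>
    d.D_eq hp (hM.deriv_fst p hp)
  have hcg : ∀ s ∈ d.I, (d.D (d.H lam) s ^ 3)⁻¹ * d.D M s = N s := fun s hs => by
    have := speed_pos h hl s
    rw [hDM s hs, D_H_eq hs]
    field_simp
  refine ⟨?_, fun p hp => ?_, hM.bottom, ?_⟩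
  · refine d.contDiffOn_succ (n := 1) hM.deriv_fst (ContDiffOn.mul ?_ ?_)
    · exact ((contDiffOn_D_H h hl).pow 3).congr fun s hs => by rw [D_H_eq hs, inv_pow]
    · refine d.contDiffOn_succ (n := 0) hM.deriv_snd (contDiffOn_zero.2 ?_)
      exact ((continuous_const.fun_mul (continuous_speed h hl)).continuousOn.fun_mul
        hM.continuousOn_fst).fun_sub
          (d.continuous_stiff.continuousOn.fun_mul (hM.continuousOn_fst.fun_sub continuousOn_const))
  · have hp' : p ∈ d.I := Ioo_subset_Icc_self hp
    rw [d.D_eq hp' ((hM.deriv_snd p hp').congr hcg (hcg p hp')), speed_eq hp', d.stiff_eq hp']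
    ring
  · rw [hDM 0 d.zero_mem_I, ← speed_zero_cube h hl, hM.top]
    have := speed_pos h hl 0
    field_simp

/-! ### The mode zero -/

theorem IsVariation.apply_zero {k : ℝ → ℝ} (hk : d.IsVariation lam k) : k 0 = 0 := by
  rw [hk.eq 0 d.zero_mem_I, intervalIntegral.integral_same]

/-- Up to a factor the only candidate is 1 - 2gρ(0) k, which satisfies the equation and the top
condition; the bottom condition is the stated equality. -/
theorem hasMode_zero_iff (h : d.IsThreshold eps) (hl : lam ∈ d.params eps) {k : ℝ → ℝ}
    (hk : d.IsVariation lam k) : d.HasMode lam 0 ↔ 2 * d.g * d.rho 0 * k d.p0 = 1 := by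
  have hc := continuous_inv_speed_cube h hl
  have hik := continuous_integral_to_zero (d.continuous_stiff.fun_mul hk.continuous)
  constructor
  · rintro ⟨M, hM, q, hq, hMq⟩
    obtain ⟨N, hP⟩ : ∃ N, d.IsModePair lam 0 M N := ⟨_, hM.isModePair h hl⟩
    set c := d.g * d.rho 0 * M 0 with hcdef
    have hMc := d.continuous_comp_clamp hP.continuousOn_fst
    set m : ℝ → ℝ := fun p => M (d.clamp p) - M 0 with hm
    have hmc : Continuous m := hMc.sub continuous_const
    have him := continuous_integral_to_zero (d.continuous_stiff.fun_mul hmc)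
    have hmI : ∀ s ∈ d.I, m s = M s - M 0 := fun s hs => by rw [hm]; simp only [d.clamp_eq hs]
    have hN : ∀ s ∈ d.I, N s = c + ∫ t in s..0, d.stiff t * m t := by
      intro s hs
      have hd : ∀ s ∈ d.I, HasDerivWithinAt N (-(d.stiff s * m s)) d.I s := fun s hs =>
        (hP.deriv_snd s hs).congr_deriv (by rw [hmI s hs]; simp)
      have := d.integral_eq_sub_I hd
        (d.continuous_stiff.fun_mul hmc).neg.continuousOn hs d.zero_mem_I hs.2
      rw [intervalIntegral.integral_neg, hP.top] at this
      rw [hcdef]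
      push_cast at this
      linarith
    have hm' : ∀ s ∈ d.I,
        m s = -∫ t in s..0, (d.speed lam t ^ 3)⁻¹ * (c + ∫ x in t..0, d.stiff x * m x) := by
      intro s hs
      have := d.integral_eq_sub_I hP.deriv_fst
        (hc.continuousOn.fun_mul hP.continuousOn_snd) hs d.zero_mem_I hs.2
      rw [d.integral_congr_I hs d.zero_mem_I (fun t ht => by rw [hN t ht])] at this
      rw [this, hmI s hs]
      ring
    -- M - M(0) and -2ck solve the same Volterra equation, so their difference solves the
    -- homogeneous one and vanishes.
    have hE : ∀ p ∈ Icc d.p0 0, m p + 2 * c * k p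
        = 0 - volterra (fun s => (d.speed lam s ^ 3)⁻¹) d.stiff (fun s => m s + 2 * c * k s) p := by
      intro p hp
      have hsum : ∀ s, ∫ t in s..0, d.stiff t * (m t + 2 * c * k t)
          = (∫ t in s..0, d.stiff t * m t) + 2 * c * ∫ t in s..0, d.stiff t * k t := fun s => by
        rw [← intervalIntegral.integral_const_mul, ← intervalIntegral.integral_add
          ((d.continuous_stiff.fun_mul hmc).intervalIntegrable _ _)
          (((d.continuous_stiff.fun_mul hk.continuous).const_mul _).intervalIntegrable _ _)]
        refine intervalIntegral.integral_congr fun t _ => ?_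
        ring
      simp only [volterra, hsum]
      rw [hm' p hp, hk.eq p hp, ← intervalIntegral.integral_neg,
        ← intervalIntegral.integral_const_mul, ← intervalIntegral.integral_add
          ((hc.fun_mul (continuous_const.fun_add him)).fun_neg.intervalIntegrable _ _)
          (((hc.fun_mul (continuous_const.fun_sub hik)).const_mul _).intervalIntegrable _ _),
        zero_sub, ← intervalIntegral.integral_neg]
      refine intervalIntegral.integral_congr fun t _ => ?_
      ring
    have hz := volterra_solution_abs_le d.p0_neg.le (fun s _ => inv_speed_cube_le h hl s)
      (fun s _ => d.abs_stiff_le s) h.small (hmc.fun_add (hk.continuous.const_mul _)).continuousOn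
      (F := fun _ => 0) (S := 0) (by simp) hE
    have hz' : ∀ p ∈ d.I, M p = M 0 - 2 * c * k p := fun p hp => by
      have := hz p hp
      rw [mul_zero, abs_nonpos_iff, hmI p hp] at this
      linarith
    have hM0 : M 0 ≠ 0 := fun h0 => hMq (by rw [hz' q hq, hcdef, h0]; ring)
    have := hz' d.p0 d.p0_mem_I
    rw [hP.bottom, hcdef] at this
    refine mul_right_cancel₀ hM0 ?_
    linarith
  · intro h1
    refine ⟨fun p => 1 - 2 * (d.g * d.rho 0) * k p, ?_, 0, d.zero_mem_I, by simp [hk.apply_zero]⟩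
    refine IsModePair.isModeSolution h hl
      (N := fun p => 2 * (d.g * d.rho 0) * (1 / 2 - ∫ t in p..0, d.stiff t * k t))
      ⟨fun p hp => ?_, fun p hp => ?_, ?_, ?_⟩
    · have hkd : HasDerivWithinAt k
          (-((d.speed lam p ^ 3)⁻¹ * (1 / 2 - ∫ t in p..0, d.stiff t * k t))) d.I p :=
        (hasDerivAt_integral_to_zero (hc.fun_mul (continuous_const.fun_sub hik))
          p).hasDerivWithinAt.congr hk.eq (hk.eq p hp)
      refine ((hkd.const_mul (2 * (d.g * d.rho 0))).const_sub 1).congr_deriv ?_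
      ring
    · refine (((hasDerivAt_integral_to_zero (d.continuous_stiff.fun_mul hk.continuous)
        p).const_sub (1 / 2)).const_mul (2 * (d.g * d.rho 0))).hasDerivWithinAt.congr_deriv ?_
      simp only [hk.apply_zero, ↓reduceIte]
      push_cast
      ring
    · linarith
    · simp only [intervalIntegral.integral_same, hk.apply_zero]
      push_cast
      ring

/-! ### Quadratic forms for the modes `n ≥ 1` -/

theorem intervalIntegrable_I {f : ℝ → ℝ} (hf : ContinuousOn f d.I) :
    IntervalIntegrable f MeasureTheory.volume d.p0 0 :=
  ContinuousOn.intervalIntegrable_of_Icc d.p0_neg.le hf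

theorem integral_mul_sub_sq {w f g : ℝ → ℝ} (hw : ContinuousOn w d.I) (hf : ContinuousOn f d.I)
    (hg : ContinuousOn g d.I) :
    ∫ s in d.p0..0, w s * (f s - g s) ^ 2 = (∫ s in d.p0..0, w s * (f s * f s))
      + (∫ s in d.p0..0, w s * (g s * g s)) - 2 * ∫ s in d.p0..0, w s * (f s * g s) := by
  have hff := intervalIntegrable_I (hw.fun_mul (hf.fun_mul hf))
  have hgg := intervalIntegrable_I (hw.fun_mul (hg.fun_mul hg))
  have hfg := intervalIntegrable_I (hw.fun_mul (hf.fun_mul hg))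
  rw [← intervalIntegral.integral_const_mul, ← intervalIntegral.integral_add hff hgg,
    ← intervalIntegral.integral_sub (hff.add hgg) (hfg.const_mul 2)]
  refine intervalIntegral.integral_congr fun s _ => ?_
  ring

/-- Cauchy–Schwarz bound of `M` by its energy. -/
theorem sq_le_energy (h : d.IsThreshold eps) (hl : lam ∈ d.params eps) {M N : ℝ → ℝ}
    (hM : ∀ p ∈ d.I, HasDerivWithinAt M ((d.speed lam p ^ 3)⁻¹ * N p) d.I p)
    (hN : ContinuousOn N d.I) (h0 : M d.p0 = 0) (hp : p ∈ d.I) :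
    M p ^ 2 ≤ (∫ s in d.p0..0, (d.speed lam s ^ 3)⁻¹)
      * ∫ s in d.p0..0, (d.speed lam s ^ 3)⁻¹ * (N s * N s) := by
  have hc := continuous_inv_speed_cube h hl
  have hpos : ∀ s, 0 < (d.speed lam s ^ 3)⁻¹ := fun s => by
    have := speed_pos h hl s
    positivity
  have hMp := d.integral_eq_sub_I hM (hc.continuousOn.fun_mul hN) d.p0_mem_I hp hp.1
  rw [h0, sub_zero] at hMp
  set w : ℝ → ℝ := fun s => (d.speed lam s ^ 3)⁻¹ with hw
  have hint : ∀ {f : ℝ → ℝ}, ContinuousOn f d.I → ∀ {x y}, x ∈ d.I → y ∈ d.I →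
      IntervalIntegrable f MeasureTheory.volume x y := fun hf _ _ hx hy =>
    (hf.mono (ordConnected_Icc.uIcc_subset hx hy)).intervalIntegrable
  have hNN := hc.continuousOn.fun_mul (hN.fun_mul hN)
  have hN1 := hc.continuousOn.fun_mul hN
  -- ∫ w (N - t)² is a nonnegative quadratic polynomial in t; its discriminant yields
  -- Cauchy–Schwarz.
  have key : ∀ t : ℝ, 0 ≤ (∫ s in d.p0..p, w s * (N s * N s)) - 2 * t * M p
      + t ^ 2 * ∫ s in d.p0..p, w s := fun t => by
    have h1 : 0 ≤ ∫ s in d.p0..p, w s * (N s - t) ^ 2 :=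
      intervalIntegral.integral_nonneg hp.1 fun s _ => mul_nonneg (hpos s).le (sq_nonneg _)
    have h2 : ∫ s in d.p0..p, w s * (N s - t) ^ 2 = (∫ s in d.p0..p, w s * (N s * N s))
        - 2 * t * (∫ s in d.p0..p, w s * N s) + t ^ 2 * ∫ s in d.p0..p, w s := by
      have i1 := hint hNN d.p0_mem_I hp
      have i2 := (hint hN1 d.p0_mem_I hp).const_mul (2 * t)
      have i3 := (hc.intervalIntegrable (μ := MeasureTheory.volume) d.p0 p).const_mul (t ^ 2)
      rw [← intervalIntegral.integral_const_mul, ← intervalIntegral.integral_const_mul,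
        ← intervalIntegral.integral_sub i1 i2, ← intervalIntegral.integral_add (i1.sub i2) i3]
      refine intervalIntegral.integral_congr fun s _ => ?_
      simp only [hw]
      ring
    rw [h2, hMp] at h1
    exact h1
  have hA1 : (∫ s in d.p0..p, w s) ≤ ∫ s in d.p0..0, w s := by
    rw [← intervalIntegral.integral_add_adjacent_intervals
      (hc.intervalIntegrable d.p0 p) (hc.intervalIntegrable p 0)]
    exact le_add_of_nonneg_right (intervalIntegral.integral_nonneg hp.2 fun s _ => (hpos s).le)
  have hJ1 : (∫ s in d.p0..p, w s * (N s * N s)) ≤ ∫ s in d.p0..0, w s * (N s * N s) := by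
    rw [← intervalIntegral.integral_add_adjacent_intervals
      (hint hNN d.p0_mem_I hp) (hint hNN hp d.zero_mem_I)]
    exact le_add_of_nonneg_right (intervalIntegral.integral_nonneg hp.2
      fun s _ => mul_nonneg (hpos s).le (mul_self_nonneg _))
  have hA0 : 0 ≤ ∫ s in d.p0..p, w s :=
    intervalIntegral.integral_nonneg hp.1 fun s _ => (hpos s).le
  have hJ0 : 0 ≤ ∫ s in d.p0..p, w s * (N s * N s) :=
    intervalIntegral.integral_nonneg hp.1 fun s _ => mul_nonneg (hpos s).le (mul_self_nonneg _)
  have hdisc := discrim_le_zero (a := ∫ s in d.p0..p, w s) (b := -2 * M p)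
    (c := ∫ s in d.p0..p, w s * (N s * N s)) (fun t => by linarith [key t])
  rw [discrim] at hdisc
  refine le_trans ?_ (mul_le_mul hA1 hJ1 hJ0 (hA0.trans hA1))
  linarith

/-- Positivity of the energy form under a smallness condition. -/
theorem energy_form_nonneg (h : d.IsThreshold eps) (hl : lam ∈ d.params eps) {M N : ℝ → ℝ}
    (hM : ∀ p ∈ d.I, HasDerivWithinAt M ((d.speed lam p ^ 3)⁻¹ * N p) d.I p)
    (hN : ContinuousOn N d.I) (h0 : M d.p0 = 0) {G : ℝ} (hG : 0 ≤ G)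
    (hsmall : (G + d.g * d.rhoSup * |d.p0|) * (∫ s in d.p0..0, (d.speed lam s ^ 3)⁻¹) ≤ 1) :
    G * M 0 ^ 2 + (∫ s in d.p0..0, d.stiff s * (M s * M s))
      ≤ ∫ s in d.p0..0, (d.speed lam s ^ 3)⁻¹ * (N s * N s) := by
  set A := ∫ s in d.p0..0, (d.speed lam s ^ 3)⁻¹
  set J := ∫ s in d.p0..0, (d.speed lam s ^ 3)⁻¹ * (N s * N s)
  have hJ : 0 ≤ J := intervalIntegral.integral_nonneg d.p0_neg.le fun s _ => by
    have := speed_pos h hl s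
    exact mul_nonneg (by positivity) (mul_self_nonneg _)
  have hb : ∀ p ∈ d.I, M p ^ 2 ≤ A * J := fun p hp => sq_le_energy h hl hM hN h0 hp
  have hR0 : 0 ≤ d.g * d.rhoSup := mul_nonneg d.g_pos.le d.rhoSup_nonneg
  -- By M² ≤ A J pointwise, both terms on the left are multiples of A J, and smallness bounds their
  -- sum by J.
  have h1 : |∫ s in d.p0..0, d.stiff s * (M s * M s)| ≤ d.g * d.rhoSup * (A * J) * -d.p0 :=
    abs_integral_to_zero_le d.p0_neg.le fun s hs => by
      rw [abs_mul, abs_mul_self, ← sq]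
      exact mul_le_mul (d.abs_stiff_le s) (hb s hs) (sq_nonneg _) hR0
  have h2 := le_of_abs_le h1
  have h3 := mul_le_mul_of_nonneg_left (hb 0 d.zero_mem_I) hG
  have h4 := mul_le_mul_of_nonneg_right hsmall hJ
  rw [abs_of_neg d.p0_neg] at h4
  linarith

/-- The case G = 0 of the condition in `energy_form_nonneg`, for functions vanishing at the top; it
holds on the whole parameter range. -/
theorem smallness (h : d.IsThreshold eps) (hl : lam ∈ d.params eps) :
    (0 + d.g * d.rhoSup * |d.p0|) * (∫ s in d.p0..0, (d.speed lam s ^ 3)⁻¹) ≤ 1 := by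
  have h1 := le_of_abs_le (abs_integral_to_zero_le d.p0_neg.le
    fun s _ => inv_speed_cube_le h hl s)
  have hR0 : 0 ≤ d.g * d.rhoSup := mul_nonneg d.g_pos.le d.rhoSup_nonneg
  have h2 := mul_le_mul_of_nonneg_left h1 (mul_nonneg hR0 (abs_nonneg d.p0))
  have := h.small
  rw [abs_of_neg d.p0_neg] at h2 ⊢
  linarith

namespace IsModePair

variable {m n : ℕ} {M N M' N' : ℝ → ℝ}

/-- The weak form of the mode `n` problem, tested against another mode. -/
theorem weak_form (h : d.IsThreshold eps) (hl : lam ∈ d.params eps) (hn : n ≠ 0)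
    (hM : d.IsModePair lam n M N) (hM' : d.IsModePair lam m M' N') :
    ((n : ℝ) ^ 2 * d.sigma + d.g * d.rho 0) * (M 0 * M' 0)
      = (n : ℝ) ^ 2 * (∫ s in d.p0..0, d.speed lam s * (M s * M' s))
        - (∫ s in d.p0..0, d.stiff s * (M s * M' s))
        + ∫ s in d.p0..0, (d.speed lam s ^ 3)⁻¹ * (N s * N' s) := by
  have hc := continuous_inv_speed_cube h hl
  have hs := continuous_speed h hl
  have hMM := hM.continuousOn_fst.fun_mul hM'.continuousOn_fst
  have c1 := (hs.continuousOn.fun_mul hMM).fun_mul (continuousOn_const (c := (n : ℝ) ^ 2))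
  have c2 := d.continuous_stiff.continuousOn.fun_mul hMM
  have c3 := hc.continuousOn.fun_mul (hM.continuousOn_snd.fun_mul hM'.continuousOn_snd)
  -- Integrating this derivative leaves only the top value, since M' vanishes at the bottom.
  have hd : ∀ p ∈ d.I, HasDerivWithinAt (fun s => N s * M' s)
      (d.speed lam p * (M p * M' p) * (n : ℝ) ^ 2 - d.stiff p * (M p * M' p)
        + (d.speed lam p ^ 3)⁻¹ * (N p * N' p)) d.I p := fun p hp => by
    refine ((hM.deriv_snd p hp).mul (hM'.deriv_fst p hp)).congr_deriv ?_
    rw [if_neg hn]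
    ring
  have := d.integral_eq_sub_I hd ((c1.fun_sub c2).fun_add c3) d.p0_mem_I d.zero_mem_I d.p0_neg.le
  rw [hM'.bottom, hM.top, intervalIntegral.integral_add
    (intervalIntegrable_I (c1.fun_sub c2)) (intervalIntegrable_I c3),
    intervalIntegral.integral_sub (intervalIntegrable_I c1) (intervalIntegrable_I c2),
    intervalIntegral.integral_mul_const] at this
  linarith

theorem integral_speed_pos (h : d.IsThreshold eps) (hl : lam ∈ d.params eps) {f : ℝ → ℝ}
    (hf : ContinuousOn f d.I) (hp : p ∈ d.I) (hfp : f p ≠ 0) :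
    0 < ∫ s in d.p0..0, d.speed lam s * (f s) ^ 2 :=
  intervalIntegral.integral_pos d.p0_neg ((continuous_speed h hl).continuousOn.fun_mul (hf.fun_pow 2))
    (fun s _ => mul_nonneg (speed_pos h hl s).le (sq_nonneg _))
    ⟨p, hp, mul_pos (speed_pos h hl p) (by positivity)⟩

/-- A mode solution with `n ≥ 1` is determined by its value at the top. -/
theorem eq_zero_of_top (h : d.IsThreshold eps) (hl : lam ∈ d.params eps) (hn : n ≠ 0)
    (hM : d.IsModePair lam n M N) (h0 : M 0 = 0) : ∀ p ∈ d.I, M p = 0 := by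
  by_contra! hne
  obtain ⟨p, hp, hMp⟩ := hne
  have h1 := integral_speed_pos h hl hM.continuousOn_fst hp hMp
  have h2 := hM.weak_form h hl hn hM
  have h3 := energy_form_nonneg h hl hM.deriv_fst hM.continuousOn_snd hM.bottom le_rfl
    (smallness h hl)
  simp only [← sq] at h2 h3
  rw [h0] at h2 h3
  -- With M(0) = 0 the weak form equates n² ∫ u M² with minus the nonnegative energy.
  have h4 : (0 : ℝ) < (n : ℝ) ^ 2 := by positivity
  have := mul_pos h4 h1
  linarith

/-- Two normalized modes with different wave numbers: relations between
`N = σ - ∫ M² / H_p` of the two. -/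
theorem pair_relations (h : d.IsThreshold eps) (hl : lam ∈ d.params eps) (hn : n ≠ 0)
    (hm : m ≠ 0) (hnm : n ≠ m) (hM : d.IsModePair lam n M N) (hM' : d.IsModePair lam m M' N')
    (h1 : M 0 = 1) (h1' : M' 0 = 1) :
    (d.sigma - ∫ s in d.p0..0, d.speed lam s * (M s * M s))
      + (d.sigma - ∫ s in d.p0..0, d.speed lam s * (M' s * M' s)) < 0 ∧
    0 ≤ (n : ℝ) ^ 2 * (d.sigma - ∫ s in d.p0..0, d.speed lam s * (M s * M s))
      + (m : ℝ) ^ 2 * (d.sigma - ∫ s in d.p0..0, d.speed lam s * (M' s * M' s)) := by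
  have hsc := (continuous_speed h hl).continuousOn (s := d.I)
  have hrc := d.continuous_stiff.continuousOn (s := d.I)
  have hc := (continuous_inv_speed_cube h hl).continuousOn (s := d.I)
  have e1 := hM.weak_form h hl hn hM'
  have e2 := hM'.weak_form h hl hm hM
  have e3 := hM.weak_form h hl hn hM
  have e4 := hM'.weak_form h hl hm hM'
  simp only [mul_comm (M' _) (M _), mul_comm (N' _) (N _)] at e2
  rw [h1, h1'] at e1 e2
  rw [h1] at e3
  rw [h1'] at e4
  have hne : (n : ℝ) ^ 2 - (m : ℝ) ^ 2 ≠ 0 := by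
    rw [sub_ne_zero]
    exact fun hh => hnm (by exact_mod_cast (sq_eq_sq₀ (by positivity) (by positivity)).1 hh)
  -- Subtracting the two mixed weak forms cancels all terms without a factor n² or m².
  have e5 : d.sigma = ∫ s in d.p0..0, d.speed lam s * (M s * M' s) :=
    mul_left_cancel₀ hne (by linarith)
  -- Equal modes would have equal N, and the top conditions would force n²σ = m²σ.
  have hex : ∃ p ∈ d.I, M p - M' p ≠ 0 := by
    by_contra! hall
    have hN : ∀ p ∈ d.I, N p = N' p := fun p hp => by
      have hd := (hM'.deriv_fst p hp).congr (fun s hs => sub_eq_zero.1 (hall s hs))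
        (sub_eq_zero.1 (hall p hp))
      have := (d.D_eq hp (hM.deriv_fst p hp)).symm.trans (d.D_eq hp hd)
      have hs := speed_pos h hl p
      exact mul_left_cancel₀ (by positivity) this
    have := hN 0 d.zero_mem_I
    rw [hM.top, hM'.top, h1, h1'] at this
    exact hne (mul_right_cancel₀ d.sigma_pos.ne' (by linarith))
  obtain ⟨p, hp, hpne⟩ := hex
  have f1 := integral_speed_pos h hl (hM.continuousOn_fst.sub hM'.continuousOn_fst) hp hpne
  have f2 := energy_form_nonneg h hl (M := fun s => M s - M' s) (N := fun s => N s - N' s)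
    (fun s hs => ((hM.deriv_fst s hs).sub (hM'.deriv_fst s hs)).congr_deriv (by ring))
    (hM.continuousOn_snd.sub hM'.continuousOn_snd) (by simp [hM.bottom, hM'.bottom]) le_rfl
    (smallness h hl)
  simp only [← sq, Pi.sub_apply] at f1 f2
  rw [integral_mul_sub_sq hsc hM.continuousOn_fst hM'.continuousOn_fst] at f1
  rw [integral_mul_sub_sq hrc hM.continuousOn_fst hM'.continuousOn_fst,
    integral_mul_sub_sq hc hM.continuousOn_snd hM'.continuousOn_snd, zero_mul, zero_add] at f2
  rw [← e5] at f1 e1 e2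
  constructor
  · linarith
  · linarith

end IsModePair

theorem HasMode.exists_normalized (h : d.IsThreshold eps) (hl : lam ∈ d.params eps) {n : ℕ}
    (hn : n ≠ 0) (hm : d.HasMode lam n) : ∃ M N, d.IsModePair lam n M N ∧ M 0 = 1 := by
  obtain ⟨M, hM, q, hq, hMq⟩ := hm
  have hP := hM.isModePair h hl
  have hM0 : M 0 ≠ 0 := fun h0 => hMq (hP.eq_zero_of_top h hl hn h0 q hq)
  exact ⟨_, _, hP.smul (M 0)⁻¹, inv_mul_cancel₀ hM0⟩

/-- At most two of the modes `n ≥ 1` occur. -/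
theorem not_three_modes (h : d.IsThreshold eps) (hl : lam ∈ d.params eps) {n : Fin 3 → ℕ}
    (hinj : Function.Injective n) (hn : ∀ i, n i ≠ 0) : ¬ ∀ i, d.HasMode lam (n i) := by
  intro hm
  choose M N hP h1 using fun i => (hm i).exists_normalized h hl (hn i)
  have hrel := fun i j (hij : i ≠ j) =>
    (hP i).pair_relations h hl (hn i) (hn j) (hinj.ne hij) (hP j) (h1 i) (h1 j)
  have hpos : ∀ i, (0 : ℝ) < (n i : ℝ) ^ 2 := fun i => by
    have := hn i
    positivity
  obtain ⟨x, hx⟩ : ∃ x : Fin 3 → ℝ,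
      x = fun i => d.sigma - ∫ s in d.p0..0, d.speed lam s * (M i s * M i s) := ⟨_, rfl⟩
  have hrel' : ∀ i j, i ≠ j → x i + x j < 0 ∧ 0 ≤ (n i : ℝ) ^ 2 * x i + (n j : ℝ) ^ 2 * x j := by
    rw [hx]
    exact hrel
  -- By the weighted sums at most one x_i is negative, while the negative plain sums allow at most
  -- one nonnegative x_i.
  have key : ∀ i j, i ≠ j → x i < 0 → 0 < x j := fun i j hij hi => by
    by_contra! hj
    have := (hrel' i j hij).2
    have := mul_neg_of_pos_of_neg (hpos i) hi
    have := mul_nonpos_of_nonneg_of_nonpos (hpos j).le hj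
    linarith
  have h01 := (hrel' 0 1 (by decide)).1
  have h02 := (hrel' 0 2 (by decide)).1
  have h12 := (hrel' 1 2 (by decide)).1
  rcases lt_or_ge (x 0) 0 with h0 | h0
  · have := key 0 1 (by decide) h0
    have := key 0 2 (by decide) h0
    linarith
  · have := key 1 2 (by decide) (by linarith)
    linarith

/-- If the energy form is nonnegative, at most one of the modes `n ≥ 1` occurs. -/
theorem mode_unique (h : d.IsThreshold eps) (hl : lam ∈ d.params eps)
    (hsmall : (d.g * d.rho 0 + d.g * d.rhoSup * |d.p0|)
      * (∫ s in d.p0..0, (d.speed lam s ^ 3)⁻¹) ≤ 1) {m n : ℕ} (hm : m ≠ 0) (hn : n ≠ 0)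
    (hmm : d.HasMode lam m) (hmn : d.HasMode lam n) : n = m := by
  by_contra hne
  obtain ⟨M, N, hP, h1⟩ := hmn.exists_normalized h hl hn
  obtain ⟨M', N', hP', h1'⟩ := hmm.exists_normalized h hl hm
  -- With L(0) = 1, the weak form turns the energy inequality into j²(σ - ∫ u L²) ≥ 0.
  have key : ∀ {j : ℕ} {L K : ℝ → ℝ}, j ≠ 0 → d.IsModePair lam j L K → L 0 = 1 →
      0 ≤ d.sigma - ∫ s in d.p0..0, d.speed lam s * (L s * L s) := by
    intro j L K hj hL h1
    have e1 := hL.weak_form h hl hj hL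
    have e2 := energy_form_nonneg h hl hL.deriv_fst hL.continuousOn_snd hL.bottom
      (mul_nonneg d.g_pos.le d.rho_zero_pos.le) hsmall
    rw [h1] at e1 e2
    have h4 : (0 : ℝ) < (j : ℝ) ^ 2 := by positivity
    refine nonneg_of_mul_nonneg_right (a := (j : ℝ) ^ 2) ?_ h4
    linarith
  have := (hP.pair_relations h hl hn hm hne hP' h1 h1').1
  linarith [key hn hP h1, key hm hP' h1']

end WaveData

/-! ### Completeness of the cosines. -/

/-- An even `2π`-periodic continuous function with vanishing cosine coefficients is zero. -/
theorem eq_zero_of_cos_coeff_eq_zero {f : ℝ → ℝ} (hf : Continuous f)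
    (hper : ∀ x, f (x + 2 * Real.pi) = f x) (heven : ∀ x, f (-x) = f x)
    (hcos : ∀ n : ℕ, ∫ x in (0 : ℝ)..(2 * Real.pi), f x * Real.cos (n * x) = 0) (x : ℝ) :
    f x = 0 := by
  have hT : Fact (0 < 2 * Real.pi) := ⟨Real.two_pi_pos⟩
  have hcos' : ∀ n : ℤ, ∫ x in (0 : ℝ)..(2 * Real.pi), f x * Real.cos (n * x) = 0 := by
    intro n
    obtain ⟨m, rfl | rfl⟩ := n.eq_nat_or_neg
    · exact_mod_cast hcos m
    · refine (intervalIntegral.integral_congr fun x _ => ?_).trans (hcos m)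
      push_cast
      rw [neg_mul, Real.cos_neg]
  -- The reflection x ↦ 2π - x preserves f and reverses the sign of the sine.
  have hsin : ∀ n : ℤ, ∫ x in (0 : ℝ)..(2 * Real.pi), f x * Real.sin (n * x) = 0 := by
    intro n
    have h1 := intervalIntegral.integral_comp_sub_left (a := 0) (b := 2 * Real.pi)
      (fun x => f x * Real.sin (n * x)) (2 * Real.pi)
    have h2 : ∀ x, f (2 * Real.pi - x) * Real.sin (n * (2 * Real.pi - x))
        = -(f x * Real.sin (n * x)) := fun x => by
      have e1 : f (2 * Real.pi - x) = f x := by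
        rw [← heven x, ← hper (-x)]
        ring_nf
      have e2 : Real.sin (n * (2 * Real.pi - x)) = -Real.sin (n * x) := by
        rw [mul_sub, Real.sin_int_mul_two_pi_sub]
      rw [e1, e2]
      ring
    simp only [h2, sub_self, sub_zero, intervalIntegral.integral_neg] at h1
    linarith
  have hperC : Function.Periodic (fun x : ℝ => (f x : ℂ)) (2 * Real.pi) := fun x => by
    simp only [hper]
  let F : C(AddCircle (2 * Real.pi), ℂ) := ⟨hperC.lift,
    continuous_coinduced_dom.mpr (Complex.continuous_ofReal.comp hf)⟩
  have hF : ∀ x : ℝ, F (x : AddCircle (2 * Real.pi)) = (f x : ℂ) := fun x => hperC.lift_coe x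
  have hc : ∀ n : ℤ, fourierCoeff F n = 0 := by
    intro n
    rw [fourierCoeff_eq_intervalIntegral _ n 0, zero_add]
    have h1 : ∀ x : ℝ, fourier (-n) (x : AddCircle (2 * Real.pi)) • F (x : AddCircle (2 * Real.pi))
        = ((f x * Real.cos (n * x) : ℝ) : ℂ)
          - Complex.I * ((f x * Real.sin (n * x) : ℝ) : ℂ) := fun x => by
      rw [fourier_coe_apply, hF]
      have e : 2 * (Real.pi : ℂ) * Complex.I * ((-n : ℤ) : ℂ) * x / ((2 * Real.pi : ℝ) : ℂ)
          = (-(n * x : ℝ) : ℝ) * Complex.I := by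
        have : (Real.pi : ℂ) ≠ 0 := by exact_mod_cast Real.pi_ne_zero
        push_cast
        field_simp
      rw [e, Complex.exp_mul_I, ← Complex.ofReal_cos, ← Complex.ofReal_sin, Real.cos_neg,
        Real.sin_neg, smul_eq_mul]
      push_cast
      ring
    have c1 : Continuous fun x => ((f x * Real.cos (n * x) : ℝ) : ℂ) := by fun_prop
    have c2 : Continuous fun x => Complex.I * ((f x * Real.sin (n * x) : ℝ) : ℂ) := by fun_prop
    simp only [h1]
    rw [intervalIntegral.integral_sub (c1.intervalIntegrable _ _) (c2.intervalIntegrable _ _),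
      intervalIntegral.integral_const_mul, intervalIntegral.integral_ofReal,
      intervalIntegral.integral_ofReal, hcos', hsin]
    simp
  -- Vanishing coefficients are summable, so the Fourier series converges pointwise to F, with sum
  -- 0.
  have hs := has_pointwise_sum_fourier_series_of_summable (f := F)
    (by rw [show fourierCoeff F = 0 from funext hc]; exact summable_zero)
    (x : AddCircle (2 * Real.pi))
  simp only [hc, zero_smul] at hs
  have := hs.unique hasSum_zero
  rw [hF] at this
  exact_mod_cast this

namespace WaveData

variable {d : WaveData} {eps lam mu p : ℝ}

/-! ### Partial derivatives on the strip -/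

theorem hasDerivWithinAt_fst_slice {v : ℝ × ℝ → ℝ} (hv : ContDiffOn ℝ 1 v d.strip) {x : ℝ × ℝ}
    (hx : x ∈ d.strip) :
    HasDerivAt (fun t => v (t, x.2)) (fderivWithin ℝ v d.strip x (1, 0)) x.1 := by
  have h1 := (hv.differentiableOn (by norm_num) x hx).hasFDerivWithinAt
  have h2 : HasDerivWithinAt (fun t : ℝ => (t, x.2)) ((1 : ℝ), (0 : ℝ)) univ x.1 :=
    ((hasDerivAt_id x.1).prodMk (hasDerivAt_const x.1 x.2)).hasDerivWithinAt
  exact hasDerivWithinAt_univ.1 (h1.comp_hasDerivWithinAt x.1 h2 (d.mapsTo_q hx.2))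

theorem hasDerivWithinAt_snd_slice {v : ℝ × ℝ → ℝ} (hv : ContDiffOn ℝ 1 v d.strip) {x : ℝ × ℝ}
    (hx : x ∈ d.strip) :
    HasDerivWithinAt (fun s => v (x.1, s)) (fderivWithin ℝ v d.strip x (0, 1)) d.I x.2 := by
  have h1 := (hv.differentiableOn (by norm_num) x hx).hasFDerivWithinAt
  have h2 : HasDerivWithinAt (fun s : ℝ => (x.1, s)) ((0 : ℝ), (1 : ℝ)) d.I x.2 :=
    ((hasDerivAt_const x.2 x.1).prodMk (hasDerivAt_id x.2)).hasDerivWithinAt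
  exact h1.comp_hasDerivWithinAt x.2 h2 (d.mapsTo_p x.1)

theorem dq_eq_fderivWithin {v : ℝ × ℝ → ℝ} (hv : ContDiffOn ℝ 1 v d.strip) {x : ℝ × ℝ}
    (hx : x ∈ d.strip) : dq v x = fderivWithin ℝ v d.strip x (1, 0) :=
  (hasDerivWithinAt_fst_slice hv hx).deriv

theorem dp_eq_fderivWithin {v : ℝ × ℝ → ℝ} (hv : ContDiffOn ℝ 1 v d.strip) {x : ℝ × ℝ}
    (hx : x ∈ d.strip) : d.dp v x = fderivWithin ℝ v d.strip x (0, 1) :=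
  (hasDerivWithinAt_snd_slice hv hx).derivWithin (d.uniqueDiffOn_I _ hx.2)

theorem one_le_natCast_succ (n : ℕ) : (1 : WithTop ℕ∞) ≤ (n : WithTop ℕ∞) + 1 := le_add_self

theorem contDiffOn_dq {v : ℝ × ℝ → ℝ} {n : ℕ} (hv : ContDiffOn ℝ (n + 1) v d.strip) :
    ContDiffOn ℝ n (dq v) d.strip :=
  ((hv.fderivWithin d.uniqueDiffOn_strip le_rfl).clm_apply contDiffOn_const).congr
    fun _ hx => dq_eq_fderivWithin (hv.of_le (one_le_natCast_succ n)) hx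

theorem contDiffOn_dp {v : ℝ × ℝ → ℝ} {n : ℕ} (hv : ContDiffOn ℝ (n + 1) v d.strip) :
    ContDiffOn ℝ n (d.dp v) d.strip :=
  ((hv.fderivWithin d.uniqueDiffOn_strip le_rfl).clm_apply contDiffOn_const).congr
    fun _ hx => dp_eq_fderivWithin (hv.of_le (one_le_natCast_succ n)) hx

theorem hasDerivAt_dq {v : ℝ × ℝ → ℝ} (hv : ContDiffOn ℝ 1 v d.strip) (hp : p ∈ d.I) (q : ℝ) :
    HasDerivAt (fun t => v (t, p)) (dq v (q, p)) q := by
  have hx : ((q, p) : ℝ × ℝ) ∈ d.strip := ⟨mem_univ _, hp⟩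
  rw [dq_eq_fderivWithin hv hx]
  exact hasDerivWithinAt_fst_slice hv hx

theorem hasDerivWithinAt_dp {v : ℝ × ℝ → ℝ} (hv : ContDiffOn ℝ 1 v d.strip) (hp : p ∈ d.I)
    (q : ℝ) : HasDerivWithinAt (fun s => v (q, s)) (d.dp v (q, p)) d.I p := by
  have hx : ((q, p) : ℝ × ℝ) ∈ d.strip := ⟨mem_univ _, hp⟩
  rw [dp_eq_fderivWithin hv hx]
  exact hasDerivWithinAt_snd_slice hv hx

theorem continuous_slice {v : ℝ × ℝ → ℝ} (hv : ContinuousOn v d.strip) (hp : p ∈ d.I) :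
    Continuous fun q => v (q, p) :=
  hv.comp_continuous (by fun_prop) fun _ => ⟨mem_univ _, hp⟩

/-! ### Cosine coefficients -/

/-- The `n`-th cosine coefficient (not normalized) of `v(·, p)`. -/
noncomputable def cosCoeff (n : ℕ) (v : ℝ × ℝ → ℝ) (p : ℝ) : ℝ :=
  ∫ q in (0 : ℝ)..(2 * Real.pi), v (q, p) * Real.cos (n * q)

theorem continuous_clamp_snd {v : ℝ × ℝ → ℝ} (hv : ContinuousOn v d.strip) :
    Continuous fun x : ℝ × ℝ => v (x.2, d.clamp x.1) :=
  hv.comp_continuous (continuous_snd.prodMk (d.continuous_clamp.comp continuous_fst))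
    fun _ => ⟨mem_univ _, d.clamp_mem _⟩

theorem continuous_cosCoeff_clamp (n : ℕ) {v : ℝ × ℝ → ℝ} (hv : ContinuousOn v d.strip) :
    Continuous fun p => cosCoeff n v (d.clamp p) := by
  refine intervalIntegral.continuous_parametric_intervalIntegral_of_continuous'
    (f := fun p q => v (q, d.clamp p) * Real.cos (n * q)) ?_ _ _
  exact (continuous_clamp_snd hv).mul (by fun_prop)

/-- By Fubini the coefficient is a primitive of the continuous coefficient of the p-derivative; this
covers the one-sided derivatives at the end points as well. -/
theorem hasDerivWithinAt_cosCoeff (n : ℕ) {v : ℝ × ℝ → ℝ} (hv : ContDiffOn ℝ 1 v d.strip)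
    (hp : p ∈ d.I) : HasDerivWithinAt (cosCoeff n v) (cosCoeff n (d.dp v) p) d.I p := by
  have hdp : ContinuousOn (d.dp v) d.strip := (contDiffOn_dp (n := 0) hv).continuousOn
  have hG := continuous_cosCoeff_clamp n hdp
  have key : ∀ s ∈ d.I, cosCoeff n v s
      = cosCoeff n v d.p0 + ∫ t in d.p0..s, cosCoeff n (d.dp v) (d.clamp t) := by
    intro s hs
    have hW : Continuous fun x : ℝ × ℝ => d.dp v (x.2, d.clamp x.1) * Real.cos (n * x.2) :=
      (continuous_clamp_snd hdp).mul (by fun_prop)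
    have hswap := MeasureTheory.intervalIntegral_intervalIntegral_swap (a := d.p0) (b := s)
      (c := 0) (d := 2 * Real.pi) (F := fun t q => d.dp v (q, d.clamp t) * Real.cos (n * q))
      ((hW.continuousOn.integrableOn_compact
        (isCompact_uIcc.prod isCompact_uIcc)).mono_set
          (prod_mono uIoc_subset_uIcc uIoc_subset_uIcc))
    have hin : ∀ q, ∫ t in d.p0..s, d.dp v (q, d.clamp t) * Real.cos (n * q)
        = v (q, s) * Real.cos (n * q) - v (q, d.p0) * Real.cos (n * q) := fun q => by
      have h1 := d.integral_eq_sub_I (fun t ht => hasDerivWithinAt_dp hv ht q)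
        (hdp.comp (by fun_prop) (d.mapsTo_p q)) d.p0_mem_I hs hs.1
      rw [intervalIntegral.integral_mul_const, ← sub_mul, ← h1,
        d.integral_congr_I d.p0_mem_I hs fun t ht => by rw [d.clamp_eq ht]]
    have hi : ∀ t ∈ d.I, IntervalIntegrable (fun q => v (q, t) * Real.cos (n * q))
        MeasureTheory.volume 0 (2 * Real.pi) := fun t ht =>
      ((continuous_slice hv.continuousOn ht).mul (by fun_prop)).intervalIntegrable _ _
    simp only [cosCoeff]
    rw [hswap]
    simp only [hin]
    rw [intervalIntegral.integral_sub (hi s hs) (hi d.p0 d.p0_mem_I)]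
    ring
  have hd := intervalIntegral.integral_hasDerivAt_right
    (hG.intervalIntegrable (μ := MeasureTheory.volume) d.p0 p)
    (hG.stronglyMeasurableAtFilter _ _) hG.continuousAt
  rw [d.clamp_eq hp] at hd
  exact (hd.const_add _).hasDerivWithinAt.congr key (key p hp)

theorem sin_natCast_mul_two_pi (n : ℕ) : Real.sin (n * (2 * Real.pi)) = 0 := by
  have := Real.sin_nat_mul_pi (2 * n)
  push_cast at this
  rw [← this]
  ring_nf

/-- Integration by parts of the second derivative. -/
theorem cosCoeff_dqq (n : ℕ) {w : ℝ × ℝ → ℝ} (hw : ContDiffOn ℝ 3 w d.strip)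
    (hper : ∀ q p, w (q + 2 * Real.pi, p) = w (q, p)) (hp : p ∈ d.I) :
    cosCoeff n (dq (dq w)) p = -((n : ℝ) ^ 2 * cosCoeff n w p) := by
  have hw1 : ContDiffOn ℝ 2 (dq w) d.strip := contDiffOn_dq (n := 2) hw
  have hw2 : ContDiffOn ℝ 1 (dq (dq w)) d.strip := contDiffOn_dq (n := 1) hw1
  have hdq : dq w (2 * Real.pi, p) = dq w (0, p) := by
    have : (fun t => w (t + 2 * Real.pi, p)) = fun t => w (t, p) := funext fun t => hper t p
    have h1 := deriv_comp_add_const (f := fun t => w (t, p)) (2 * Real.pi) (0 : ℝ)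
    rw [this, zero_add] at h1
    exact h1.symm
  have hd : ∀ q : ℝ, HasDerivAt
      (fun t => dq w (t, p) * Real.cos (n * t) + w (t, p) * (n * Real.sin (n * t)))
      (dq (dq w) (q, p) * Real.cos (n * q) + (n : ℝ) ^ 2 * (w (q, p) * Real.cos (n * q))) q := by
    intro q
    have hl : HasDerivAt (fun t : ℝ => (n : ℝ) * t) n q := by
      simpa using (hasDerivAt_id q).const_mul (n : ℝ)
    have h1 := (hasDerivAt_dq (hw1.of_le (by norm_num)) hp q).mul hl.cos
    have h2 := (hasDerivAt_dq (hw.of_le (by norm_num)) hp q).mul (hl.sin.const_mul (n : ℝ))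
    refine (h1.add h2).congr_deriv ?_
    ring
  have i1 : Continuous fun q => dq (dq w) (q, p) * Real.cos (n * q) :=
    (continuous_slice hw2.continuousOn hp).mul (by fun_prop)
  have i2 : Continuous fun q => (n : ℝ) ^ 2 * (w (q, p) * Real.cos (n * q)) :=
    ((continuous_slice hw.continuousOn hp).mul (by fun_prop)).const_mul _
  have := intervalIntegral.integral_eq_sub_of_hasDerivAt (fun q _ => hd q)
    ((i1.fun_add i2).intervalIntegrable 0 (2 * Real.pi))
  rw [intervalIntegral.integral_add (i1.intervalIntegrable _ _) (i2.intervalIntegrable _ _),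
    intervalIntegral.integral_const_mul, hdq, Real.cos_nat_mul_two_pi, sin_natCast_mul_two_pi] at this
  have h0 := hper 0 p
  rw [zero_add] at h0
  simp only [mul_zero, Real.cos_zero, Real.sin_zero, add_zero, sub_self] at this
  simp only [cosCoeff]
  linarith

theorem integral_cos_natCast (n : ℕ) :
    ∫ q in (0 : ℝ)..(2 * Real.pi), Real.cos (n * q) = if n = 0 then 2 * Real.pi else 0 := by
  split_ifs with hn
  · simp [hn]
  · have hn' : (n : ℝ) ≠ 0 := by exact_mod_cast hn
    rw [intervalIntegral.integral_comp_mul_left (fun x => Real.cos x) hn', integral_cos,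
      sin_natCast_mul_two_pi]
    simp

/-! ### The null space of the linearization -/

/-- The equations satisfied by elements of the null space. -/
theorem mem_nullSpace_iff (h : d.IsThreshold eps) (hl : lam ∈ d.params eps) (w : d.X) :
    w ∈ d.nullSpace lam ↔
      (∀ q, ∀ p ∈ d.I, d.speed lam p ^ 3 * d.dp (d.dp w) (q, p)
        + 3 * d.speed lam p * (d.bern p - d.stiff p * d.fall lam p) * d.dp w (q, p)
        = -(d.speed lam p * dq (dq w) (q, p))
          - d.stiff p * ((w : ℝ × ℝ → ℝ) (q, p) - depth w)) ∧
      ∀ q, d.speed lam 0 ^ 3 * d.dp w (q, 0)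
        = d.g * d.rho 0 * (w : ℝ × ℝ → ℝ) (q, 0) - d.sigma * dq (dq w) (q, 0) := by
  rw [nullSpace, LinearMap.mem_ker, linearization, LinearMap.coe_mk, AddHom.coe_mk,
    Prod.mk_eq_zero, funext_iff, funext_iff]
  -- Multiplication by the cube of the speed gives divergence form: the left-hand side is (u³
  -- w_p)_p.
  refine and_congr ⟨fun hx q p hp => ?_, fun hx x => ?_⟩ (forall_congr' fun q => ?_)
  · have := hx ⟨(q, p), mem_univ _, hp⟩
    rw [lineDeriv_F1] at this
    simp only [Pi.zero_apply] at this
    have hs := speed_pos h hl p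
    rw [D_H_eq hp, ← d.bern_eq hp] at this
    have hr := d.stiff_eq hp
    have hf := fall_eq (lam := lam) hp
    have hr' : d.g * d.D d.rho p = -d.stiff p := by rw [hr, neg_neg]
    have hf' : d.H lam p - d.H lam 0 = -d.fall lam p := by rw [hf, neg_sub]
    rw [hr', hf'] at this
    field_simp at this
    linear_combination this
  · obtain ⟨⟨q, p⟩, -, hp⟩ := x
    have := hx q p hp
    rw [lineDeriv_F1]
    simp only [Pi.zero_apply]
    have hs := speed_pos h hl p
    simp only at hp
    rw [D_H_eq hp, ← d.bern_eq hp]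
    have hr' : d.g * d.D d.rho p = -d.stiff p := by rw [d.stiff_eq hp, neg_neg]
    have hf' : d.H lam p - d.H lam 0 = -d.fall lam p := by rw [fall_eq hp, neg_sub]
    rw [hr', hf']
    field_simp
    linear_combination this
  · rw [lineDeriv_F2, Pi.zero_apply, D_H_eq d.zero_mem_I, Q_eq h hl, fall_eq d.p0_mem_I,
      (isLaminar h hl).bottom]
    have hs := speed_pos h hl 0
    -- Makes 2gρ(0)H(0) - Q equal to -u(0)², so that the boundary component is 2u(0)⁻² times the
    -- stated condition.
    have hlam : lam = d.speed lam 0 ^ 2 := by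
      rw [speed_zero h hl, Real.sq_sqrt (lam_pos h hl).le]
    have e : 2 * d.g * d.rho 0 * d.H lam 0 - (lam + 2 * d.g * d.rho 0 * (d.H lam 0 - 0))
        = -d.speed lam 0 ^ 2 := by
      rw [← hlam]
      ring
    rw [e]
    have e2 : (d.speed lam 0)⁻¹ ^ 2 * (2 * d.g * d.rho 0 * (w : ℝ × ℝ → ℝ) (q, 0)
          - 2 * d.sigma * dq (dq w) (q, 0))
        + 2 * (d.speed lam 0)⁻¹ * -d.speed lam 0 ^ 2 * d.dp w (q, 0)
        = 2 * (d.speed lam 0)⁻¹ ^ 2 * (d.g * d.rho 0 * (w : ℝ × ℝ → ℝ) (q, 0)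
          - d.sigma * dq (dq w) (q, 0) - d.speed lam 0 ^ 3 * d.dp w (q, 0)) := by
      field_simp
      ring
    rw [e2, mul_eq_zero_iff_left (by positivity), sub_eq_zero, eq_comm]

/-- Integrate the divergence form and the top condition against cos(nq), integrating w_qq by parts
twice. -/
theorem cosCoeff_isModePair (h : d.IsThreshold eps) (hl : lam ∈ d.params eps) (n : ℕ) {w : d.X}
    (hw : w ∈ d.nullSpace lam) :
    d.IsModePair lam n (cosCoeff n w) (fun p => d.speed lam p ^ 3 * cosCoeff n (d.dp w) p) := by
  obtain ⟨-, hper, -, hbot, hC, -⟩ := w.2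
  obtain ⟨hint, htop⟩ := (mem_nullSpace_iff h hl w).1 hw
  have hwp : ContDiffOn ℝ 2 (d.dp w) d.strip := contDiffOn_dp (n := 2) hC
  have hwpp : ContDiffOn ℝ 1 (d.dp (d.dp w)) d.strip := contDiffOn_dp (n := 1) hwp
  have hwqq : ContDiffOn ℝ 1 (dq (dq w)) d.strip :=
    contDiffOn_dq (n := 1) (contDiffOn_dq (n := 2) hC)
  have hi : ∀ {v : ℝ × ℝ → ℝ}, ContinuousOn v d.strip → ∀ {p}, p ∈ d.I →
      IntervalIntegrable (fun q => v (q, p) * Real.cos (n * q)) MeasureTheory.volume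
        0 (2 * Real.pi) := fun hv p hp =>
    ((continuous_slice hv hp).mul (by fun_prop)).intervalIntegrable _ _
  refine ⟨fun p hp => ?_, fun p hp => ?_, ?_, ?_⟩
  · refine (hasDerivWithinAt_cosCoeff n (hC.of_le (by norm_num)) hp).congr_deriv ?_
    have := speed_pos h hl p
    field_simp
  · refine (((hasDerivWithinAt_speed h hl hp).pow 3).mul
      (hasDerivWithinAt_cosCoeff n (hwp.of_le (by norm_num)) hp)).congr_deriv ?_
    have hs := speed_pos h hl p
    have e1 : d.speed lam p ^ 3 * cosCoeff n (d.dp (d.dp w)) p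
        + 3 * d.speed lam p * (d.bern p - d.stiff p * d.fall lam p) * cosCoeff n (d.dp w) p
        = -(d.speed lam p * cosCoeff n (dq (dq w)) p) - d.stiff p * (cosCoeff n w p
          - depth w * ∫ q in (0 : ℝ)..(2 * Real.pi), Real.cos (n * q)) := by
      have j1 := hi hwpp.continuousOn hp
      have j2 := hi hwp.continuousOn hp
      have j3 := hi hwqq.continuousOn hp
      have j3' : IntervalIntegrable
          (fun q => -(d.speed lam p * (dq (dq w) (q, p) * Real.cos (n * q))))
          MeasureTheory.volume 0 (2 * Real.pi) := (j3.const_mul _).neg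
      have j4 := hi hC.continuousOn hp
      have j5 : IntervalIntegrable (fun q : ℝ => Real.cos (n * q)) MeasureTheory.volume
        0 (2 * Real.pi) := (by fun_prop : Continuous fun q : ℝ => Real.cos (n * q)).intervalIntegrable _ _
      simp only [cosCoeff]
      rw [← intervalIntegral.integral_const_mul, ← intervalIntegral.integral_const_mul,
        ← intervalIntegral.integral_const_mul, ← intervalIntegral.integral_const_mul,
        ← intervalIntegral.integral_add (j1.const_mul _) (j2.const_mul _),
        ← intervalIntegral.integral_sub j4 (j5.const_mul _),
        ← intervalIntegral.integral_const_mul, ← intervalIntegral.integral_neg,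
        ← intervalIntegral.integral_sub j3' ((j4.sub (j5.const_mul _)).const_mul _)]
      refine intervalIntegral.integral_congr fun q _ => ?_
      linear_combination Real.cos (n * q) * hint q p hp
    -- The average is seen by n = 0 only, and there it is the nonlocal term M(0) of the mode-0
    -- problem.
    have e2 : depth w * (∫ q in (0 : ℝ)..(2 * Real.pi), Real.cos (n * q))
        = if n = 0 then cosCoeff n w 0 else 0 := by
      rw [integral_cos_natCast]
      split_ifs with hn
      · have := Real.pi_ne_zero
        simp only [depth, cosCoeff, hn, CharP.cast_eq_zero, zero_mul, Real.cos_zero, mul_one]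
        field_simp
      · rw [mul_zero]
    rw [e2, cosCoeff_dqq n hC hper hp] at e1
    have e3 : 3 * d.speed lam p ^ 2 * ((d.bern p - d.stiff p * d.fall lam p) / d.speed lam p)
        = 3 * d.speed lam p * (d.bern p - d.stiff p * d.fall lam p) := by
      field_simp
    simp only [Nat.cast_ofNat, Nat.add_one_sub_one, Pi.pow_apply]
    rw [e3]
    linear_combination e1
  · simp [cosCoeff, hbot]
  · have j4 := hi hC.continuousOn d.zero_mem_I
    have j3 := hi hwqq.continuousOn d.zero_mem_I
    have e1 : d.speed lam 0 ^ 3 * cosCoeff n (d.dp w) 0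
        = d.g * d.rho 0 * cosCoeff n w 0 - d.sigma * cosCoeff n (dq (dq w)) 0 := by
      simp only [cosCoeff]
      rw [← intervalIntegral.integral_const_mul, ← intervalIntegral.integral_const_mul,
        ← intervalIntegral.integral_const_mul,
        ← intervalIntegral.integral_sub (j4.const_mul _) (j3.const_mul _)]
      refine intervalIntegral.integral_congr fun q _ => ?_
      linear_combination Real.cos (n * q) * htop q
    rw [cosCoeff_dqq n hC hper d.zero_mem_I] at e1
    rw [e1]
    ring

end WaveData

/-! ### Hölder regularity of laminar flows and modes. -/

/-- `u` is `k` times differentiable within `s`, the `k`-th derivative being `α`-Hölder. -/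
def HolderChain (α : ℝ) (s : Set ℝ) : ℕ → (ℝ → ℝ) → Prop
  | 0, u => IsHolderOn α u s
  | k + 1, u => ∃ u', HolderChain α s k u' ∧ ∀ x ∈ s, HasDerivWithinAt u (u' x) s x

/-- The Lipschitz bound serves for |a - b| ≤ 1, the bound 2 otherwise. -/
theorem abs_cos_sub_cos_le_rpow {α : ℝ} (h0 : 0 ≤ α) (h1 : α ≤ 1) (a b : ℝ) :
    |Real.cos a - Real.cos b| ≤ 2 * |a - b| ^ α := by
  have hl : |Real.cos a - Real.cos b| ≤ |a - b| := by
    have := Real.lipschitzWith_cos.dist_le_mul a b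
    simpa [Real.dist_eq] using this
  rcases le_total |a - b| 1 with h | h
  · have := Real.rpow_le_rpow_of_exponent_ge' (abs_nonneg (a - b)) h h0 h1
    rw [Real.rpow_one] at this
    have := abs_nonneg (a - b)
    linarith
  · have e1 : 1 ≤ |a - b| ^ α := Real.one_le_rpow h h0
    have e2 : |Real.cos a - Real.cos b| ≤ 2 := by
      refine (abs_sub _ _).trans ?_
      linarith [Real.abs_cos_le_one a, Real.abs_cos_le_one b]
    linarith

namespace WaveData

variable {d : WaveData} {eps lam mu p : ℝ}

theorem dist_le_of_mem_I {x y : ℝ} (hx : x ∈ d.I) (hy : y ∈ d.I) : dist x y ≤ -d.p0 := by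
  rw [Real.dist_eq, abs_le]
  exact ⟨by linarith [hx.1, hy.2], by linarith [hx.2, hy.1]⟩

/-- Lipschitz implies Hölder on a bounded interval: the surplus power of the distance is at most
|p0|^(1-α). -/
theorem isHolderOn_of_bound {u u' : ℝ → ℝ} {C : ℝ}
    (hu : ∀ x ∈ d.I, HasDerivWithinAt u (u' x) d.I x) (hC : ∀ x ∈ d.I, |u' x| ≤ C) :
    IsHolderOn d.alpha u d.I := by
  refine ⟨C * (-d.p0) ^ (1 - d.alpha), fun x hx y hy => ?_⟩
  have hC0 := (abs_nonneg _).trans (hC x hx)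
  have h1 : ‖u x - u y‖ ≤ C * ‖x - y‖ :=
    Convex.norm_image_sub_le_of_norm_hasDerivWithin_le hu hC (convex_Icc _ _) hy hx
  refine h1.trans ?_
  rw [← dist_eq_norm, mul_assoc]
  refine mul_le_mul_of_nonneg_left ?_ hC0
  calc dist x y = dist x y ^ (1 - d.alpha) * dist x y ^ d.alpha := by
        rw [← Real.rpow_add_of_nonneg dist_nonneg (by linarith [d.alpha_lt_one]) d.alpha_pos.le]
        simp
    _ ≤ _ := mul_le_mul_of_nonneg_right (Real.rpow_le_rpow dist_nonneg (dist_le_of_mem_I hx hy)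
        (by linarith [d.alpha_lt_one])) (Real.rpow_nonneg dist_nonneg _)

theorem exists_bound_of_isHolderOn {u : ℝ → ℝ} (hu : IsHolderOn d.alpha u d.I) :
    ∃ C, 0 ≤ C ∧ ∀ x ∈ d.I, |u x| ≤ C := by
  obtain ⟨C, hC⟩ := hu
  refine ⟨|u 0| + |C| * (-d.p0) ^ d.alpha,
    add_nonneg (abs_nonneg _) (mul_nonneg (abs_nonneg _)
      (Real.rpow_nonneg (neg_nonneg.2 d.p0_neg.le) _)), fun x hx => ?_⟩
  have h1 := hC x hx 0 d.zero_mem_I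
  have h2 : C * dist x 0 ^ d.alpha ≤ |C| * (-d.p0) ^ d.alpha :=
    mul_le_mul (le_abs_self C) (Real.rpow_le_rpow dist_nonneg (dist_le_of_mem_I hx d.zero_mem_I)
      d.alpha_pos.le) (Real.rpow_nonneg dist_nonneg _) (abs_nonneg _)
  rw [Real.norm_eq_abs] at h1
  have h3 := abs_sub_abs_le_abs_sub (u x) (u 0)
  linarith

theorem continuousOn_of_isHolderOn {u : ℝ → ℝ} (hu : IsHolderOn d.alpha u d.I) :
    ContinuousOn u d.I := by
  obtain ⟨C, hC⟩ := hu
  intro x hx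
  rw [ContinuousWithinAt, tendsto_iff_dist_tendsto_zero]
  have h0 : Filter.Tendsto (fun y => C * dist y x ^ d.alpha) (nhdsWithin x d.I) (nhds 0) := by
    have : Continuous fun y => C * dist y x ^ d.alpha :=
      (((continuous_id.dist continuous_const).rpow_const fun _ => Or.inr d.alpha_pos.le)).const_mul C
    have := (this.tendsto x).mono_left (nhdsWithin_le_nhds (s := d.I))
    simpa [Real.zero_rpow d.alpha_pos.ne'] using this
  refine squeeze_zero' (Filter.Eventually.of_forall fun _ => dist_nonneg) ?_ h0
  filter_upwards [self_mem_nhdsWithin] with y hy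
  rw [dist_eq_norm]
  exact hC y hy x hx

/-- Abbreviation of `HolderChain` for the interval and the exponent of the data. -/
abbrev Reg (d : WaveData) : ℕ → (ℝ → ℝ) → Prop := HolderChain d.alpha d.I

namespace Reg

variable {k : ℕ} {u v : ℝ → ℝ}

theorem of_succ : ∀ {k : ℕ} {u : ℝ → ℝ}, d.Reg (k + 1) u → d.Reg k u
  | 0, _, ⟨_, h, hd⟩ => by
    obtain ⟨C, -, hC⟩ := exists_bound_of_isHolderOn h
    exact isHolderOn_of_bound hd hC
  | _ + 1, _, ⟨u', h, hd⟩ => ⟨u', of_succ h, hd⟩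

theorem congr : ∀ {k : ℕ} {u v : ℝ → ℝ}, d.Reg k u → (∀ x ∈ d.I, v x = u x) → d.Reg k v
  | 0, _, _, ⟨C, h⟩, he => ⟨C, fun x hx y hy => by
      rw [he x hx, he y hy]
      exact h x hx y hy⟩
  | _ + 1, _, _, ⟨u', h, hd⟩, he => ⟨u', h, fun x hx => (hd x hx).congr he (he x hx)⟩

theorem const (c : ℝ) : ∀ k, d.Reg k fun _ => c
  | 0 => ⟨0, fun x _ y _ => by simp⟩
  | k + 1 => ⟨fun _ => 0, const 0 k, fun x _ => hasDerivWithinAt_const _ _ _⟩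

theorem add : ∀ {k : ℕ} {u v : ℝ → ℝ}, d.Reg k u → d.Reg k v → d.Reg k fun x => u x + v x
  | 0, _, _, ⟨C, h⟩, ⟨C', h'⟩ => ⟨C + C', fun x hx y hy => by
      rw [add_sub_add_comm, add_mul]
      exact (norm_add_le _ _).trans (add_le_add (h x hx y hy) (h' x hx y hy))⟩
  | _ + 1, _, _, ⟨u', h, hd⟩, ⟨v', h', hd'⟩ =>
    ⟨_, add h h', fun x hx => (hd x hx).add (hd' x hx)⟩

theorem mul : ∀ {k : ℕ} {u v : ℝ → ℝ}, d.Reg k u → d.Reg k v → d.Reg k fun x => u x * v x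
  | 0, u, v, hu, hv => by
    obtain ⟨K, hK0, hK⟩ := exists_bound_of_isHolderOn hu
    obtain ⟨L, hL0, hL⟩ := exists_bound_of_isHolderOn hv
    obtain ⟨C, hC⟩ := hu
    obtain ⟨C', hC'⟩ := hv
    refine ⟨K * C' + L * C, fun x hx y hy => ?_⟩
    have e : u x * v x - u y * v y = u x * (v x - v y) + (u x - u y) * v y := by ring
    rw [e]
    refine (norm_add_le _ _).trans ?_
    rw [norm_mul, norm_mul]
    have h1 := mul_le_mul (hK x hx) (hC' x hx y hy) (norm_nonneg _) hK0
    have h2 := mul_le_mul (hL y hy) (hC x hx y hy) (norm_nonneg _) hL0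
    simp only [Real.norm_eq_abs] at h1 h2 ⊢
    linarith
  | _ + 1, _, _, ⟨u', h, hd⟩, ⟨v', h', hd'⟩ =>
    ⟨_, add (mul h (of_succ ⟨v', h', hd'⟩)) (mul (of_succ ⟨u', h, hd⟩) h'),
      fun x hx => (hd x hx).mul (hd' x hx)⟩

theorem const_mul (c : ℝ) (h : d.Reg k u) : d.Reg k fun x => c * u x := (const c k).mul h

theorem sub (h : d.Reg k u) (h' : d.Reg k v) : d.Reg k fun x => u x - v x :=
  (h.add (h'.const_mul (-1))).congr fun x _ => by ring

theorem pow_two (h : d.Reg k u) : d.Reg k fun x => u x ^ 2 :=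
  (h.mul h).congr fun x _ => by ring

theorem pow_three (h : d.Reg k u) : d.Reg k fun x => u x ^ 3 :=
  (h.mul h.pow_two).congr fun x _ => by ring

theorem contDiffOn : ∀ {k : ℕ} {u : ℝ → ℝ}, d.Reg k u → ContDiffOn ℝ k u d.I
  | 0, _, h => contDiffOn_zero.2 (continuousOn_of_isHolderOn h)
  | k + 1, _, ⟨_, h, hd⟩ => d.contDiffOn_succ (n := k) hd (contDiffOn h)

theorem zero_of_continuousOn {u' : ℝ → ℝ} (hd : ∀ x ∈ d.I, HasDerivWithinAt u (u' x) d.I x)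
    (hc : ContinuousOn u' d.I) : d.Reg 0 u := by
  obtain ⟨C, hC⟩ := isCompact_Icc.exists_bound_of_continuousOn hc
  exact isHolderOn_of_bound hd hC

end Reg

theorem reg_of_isHolderClass {a b : ℝ} (hab : a < b) {f : ℝ → ℝ} {α : ℝ} :
    ∀ {k : ℕ}, IsHolderClass k α f a b →
      ∀ j ≤ k, HolderChain α (Icc a b) j (iteratedDerivWithin (k - j) f (Icc a b))
  | k, hf, 0, _ => hf.2
  | k, hf, j + 1, hj => by
    refine ⟨iteratedDerivWithin (k - j) f (Icc a b),
      reg_of_isHolderClass hab hf j (by omega), fun x hx => ?_⟩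
    have e : k - j = k - (j + 1) + 1 := by omega
    rw [e, iteratedDerivWithin_succ]
    exact (hf.1.differentiableOn_iteratedDerivWithin (by exact_mod_cast (by omega))
      (uniqueDiffOn_Icc hab) x hx).hasDerivWithinAt

theorem reg_stiff (d : WaveData) : d.Reg 1 d.stiff := by
  have h1 : d.Reg 1 (iteratedDerivWithin 1 d.rho d.I) :=
    reg_of_isHolderClass d.p0_neg d.rho_class 1 (by norm_num)
  refine (h1.const_mul (-d.g)).congr fun x hx => ?_
  rw [d.stiff_eq hx, iteratedDerivWithin_one, D]
  ring

theorem reg_bern (d : WaveData) : d.Reg 1 d.bern := by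
  have h0 : (0 : ℝ) < |d.p0| := abs_pos.2 d.p0_neg.ne
  obtain ⟨u', ⟨C, hC⟩, hd⟩ : HolderChain d.alpha (Icc 0 |d.p0|) 1 _ :=
    reg_of_isHolderClass h0 d.beta_class 1 le_rfl
  simp only [Nat.sub_self, iteratedDerivWithin_zero] at hd
  refine Reg.congr (u := fun x => d.beta (-x)) ⟨fun x => -u' (-x), ⟨C, fun x hx y hy => ?_⟩,
    fun x hx => ?_⟩ fun x hx => d.bern_eq hx
  · have := hC (-x) (d.neg_mem hx) (-y) (d.neg_mem hy)
    rw [dist_neg_neg] at this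
    rwa [← neg_sub', norm_neg]
  · have := (hd (-x) (d.neg_mem hx)).scomp x (hasDerivWithinAt_id x d.I).neg
      fun y hy => d.neg_mem hy
    exact this.congr_deriv (by simp)

theorem reg_D_H (h : d.IsThreshold eps) (hl : lam ∈ d.params eps) :
    d.Reg 2 (d.D (d.H lam)) ∧ d.Reg 1 (d.fall lam) := by
  have hd : ∀ p ∈ d.I, HasDerivWithinAt (d.D (d.H lam))
      (-(d.D (d.H lam) p) ^ 3 * (d.bern p - d.stiff p * d.fall lam p)) d.I p := fun p hp =>
    D_D_H_eq h hl hp ▸ hasDerivWithinAt_D_H h hl hp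
  have h0 : d.Reg 0 (d.D (d.H lam)) := Reg.zero_of_continuousOn hd
    (((continuousOn_D_H h hl).pow 3).neg.mul
      (d.continuous_bern.sub (d.continuous_stiff.mul (continuous_fall h hl))).continuousOn)
  have hf : d.Reg 1 (d.fall lam) := by
    refine ⟨_, h0.const_mul (-1), fun p hp => ?_⟩
    refine (((hasDerivWithinAt_H h hl hp).const_sub (d.H lam 0)).congr
      (fun s hs => fall_eq hs) (fall_eq hp)).congr_deriv (by ring)
  -- Each pass through the equation gains one derivative, until the C^{1+α} coefficients set the
  -- limit.
  have hstep : ∀ k ≤ 1, d.Reg k (d.D (d.H lam)) → d.Reg (k + 1) (d.D (d.H lam)) := by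
    intro k hk hr
    have hc : d.Reg k fun p => d.bern p - d.stiff p * d.fall lam p := by
      have : d.Reg 1 fun p => d.bern p - d.stiff p * d.fall lam p :=
        d.reg_bern.sub (d.reg_stiff.mul hf)
      interval_cases k
      · exact this.of_succ
      · exact this
    refine ⟨_, hr.pow_three.mul (hc.const_mul (-1)), fun p hp => (hd p hp).congr_deriv (by ring)⟩
  exact ⟨hstep 1 le_rfl (hstep 0 zero_le_one h0), hf⟩

/-- The derivative of the first component of a mode pair, in terms of `H`. -/
theorem IsModePair.hasDerivWithinAt_deriv (h : d.IsThreshold eps) (hl : lam ∈ d.params eps)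
    {n : ℕ} (hn : n ≠ 0) {M N : ℝ → ℝ} (hM : d.IsModePair lam n M N) (hp : p ∈ d.I) :
    HasDerivWithinAt (fun s => (d.speed lam s ^ 3)⁻¹ * N s)
      (-3 * d.D (d.H lam) p ^ 2 * (d.bern p - d.stiff p * d.fall lam p)
          * ((d.speed lam p ^ 3)⁻¹ * N p)
        + (n : ℝ) ^ 2 * (d.D (d.H lam) p ^ 2 * M p)
        - d.stiff p * (d.D (d.H lam) p ^ 3 * M p)) d.I p := by
  have hs := speed_pos h hl p
  refine ((((hasDerivWithinAt_speed h hl hp).pow 3).inv (pow_pos hs 3).ne').mul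
    (hM.deriv_snd p hp)).congr_deriv ?_
  rw [if_neg hn, D_H_eq hp]
  simp only [Pi.pow_apply, Pi.inv_apply, Nat.cast_ofNat, Nat.add_one_sub_one]
  field_simp
  ring

/-- Bootstrap for M_p through the second-order equation, whose coefficients are C^{1+α}; so M_p is
C^{2+α}. -/
theorem IsModePair.reg (h : d.IsThreshold eps) (hl : lam ∈ d.params eps)
    {n : ℕ} (hn : n ≠ 0) {M N : ℝ → ℝ} (hM : d.IsModePair lam n M N) : d.Reg 3 M := by
  obtain ⟨hH, hf⟩ := reg_D_H h hl
  have hd := fun p (hp : p ∈ d.I) => hM.hasDerivWithinAt_deriv h hl hn hp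
  set m : ℝ → ℝ := fun s => (d.speed lam s ^ 3)⁻¹ * N s with hm
  have hmc : ContinuousOn m d.I :=
    (continuous_inv_speed_cube h hl).continuousOn.mul hM.continuousOn_snd
  have hcoef : d.Reg 1 fun p => -3 * d.D (d.H lam) p ^ 2 * (d.bern p - d.stiff p * d.fall lam p) :=
    (hH.of_succ.pow_two.const_mul (-3)).mul (d.reg_bern.sub (d.reg_stiff.mul hf))
  have hstep : ∀ k ≤ 1, d.Reg k m → d.Reg k M → d.Reg (k + 1) m := by
    intro k hk hr hrM
    have hle : ∀ {u}, d.Reg 1 u → d.Reg k u := fun hu => by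
      interval_cases k
      · exact hu.of_succ
      · exact hu
    exact ⟨_, (((hle hcoef).mul hr).add (((hle hH.of_succ.pow_two).mul hrM).const_mul _)).sub
      ((hle d.reg_stiff).mul ((hle hH.of_succ.pow_three).mul hrM)), hd⟩
  have hM0 : d.Reg 0 M := Reg.zero_of_continuousOn hM.deriv_fst hmc
  have hm0 : d.Reg 0 m := by
    have hHc := continuousOn_D_H h hl
    refine Reg.zero_of_continuousOn hd ?_
    exact (((((hHc.pow 2).const_mul (-3)).mul (d.continuous_bern.sub
      (d.continuous_stiff.mul (continuous_fall h hl))).continuousOn).mul hmc).add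
        (((hHc.pow 2).mul hM.continuousOn_fst).const_mul _)).sub
      (d.continuous_stiff.continuousOn.mul ((hHc.pow 3).mul hM.continuousOn_fst))
  have hm1 := hstep 0 zero_le_one hm0 hM0
  have hM1 : d.Reg 1 M := ⟨m, hm0, hM.deriv_fst⟩
  exact ⟨m, hstep 1 le_rfl hm1 hM1, hM.deriv_fst⟩

/-! ### Separated functions on the strip -/

theorem contDiffOn_separated {F : Type*} [NormedAddCommGroup F] [NormedSpace ℝ F] {k : ℕ}
    {u : ℝ → ℝ} (hu : d.Reg k u) (φ : ℝ) (v : F) :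
    ContDiffOn ℝ k (fun x : ℝ × ℝ => (u x.2 * Real.cos (x.1 + φ)) • v) d.strip := by
  have h1 : ContDiffOn ℝ k (fun x : ℝ × ℝ => u x.2) d.strip :=
    hu.contDiffOn.comp contDiff_snd.contDiffOn fun _ hx => hx.2
  have h2 : ContDiff ℝ k fun x : ℝ × ℝ => Real.cos (x.1 + φ) :=
    Real.contDiff_cos.comp (contDiff_fst.add contDiff_const)
  exact (h1.mul h2.contDiffOn).smul contDiffOn_const

/-- Differentiating the cosine shifts its phase by π/2. With a free phase and a free vector, sums of
such functions are closed under differentiation. -/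
theorem hasFDerivWithinAt_separated {F : Type*} [NormedAddCommGroup F] [NormedSpace ℝ F]
    {u u' : ℝ → ℝ} (hu : ∀ p ∈ d.I, HasDerivWithinAt u (u' p) d.I p) (φ : ℝ) (v : F) {x : ℝ × ℝ}
    (hx : x ∈ d.strip) :
    HasFDerivWithinAt (fun x : ℝ × ℝ => (u x.2 * Real.cos (x.1 + φ)) • v)
      ((u' x.2 * Real.cos (x.1 + φ)) • (ContinuousLinearMap.snd ℝ ℝ ℝ).smulRight v
        + (u x.2 * Real.cos (x.1 + (φ + Real.pi / 2))) •
          (ContinuousLinearMap.fst ℝ ℝ ℝ).smulRight v) d.strip x := by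
  have h1 : HasFDerivWithinAt (fun x : ℝ × ℝ => u x.2)
      (u' x.2 • ContinuousLinearMap.snd ℝ ℝ ℝ) d.strip x :=
    (hu x.2 hx.2).comp_hasFDerivWithinAt x hasFDerivWithinAt_snd fun _ hy => hy.2
  have h2 : HasFDerivWithinAt (fun x : ℝ × ℝ => Real.cos (x.1 + φ))
      (-Real.sin (x.1 + φ) • ContinuousLinearMap.fst ℝ ℝ ℝ) d.strip x :=
    (hasFDerivWithinAt_fst.add_const φ).cos
  refine ((h1.mul h2).smul_const v).congr_fderiv ?_
  rw [← add_assoc, Real.cos_add_pi_div_two]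
  ext <;> simp [mul_comm, mul_smul]

/-- Induction on k for all phases and target spaces at once: the derivative is a sum of two
functions of the same kind, one with u' and one with u. -/
theorem isHolderOn_iteratedFDerivWithin_separated : ∀ {k : ℕ} {F : Type} [NormedAddCommGroup F]
    [NormedSpace ℝ F] {u : ℝ → ℝ}, d.Reg k u → ∀ (φ : ℝ) (v : F),
    IsHolderOn d.alpha (iteratedFDerivWithin ℝ k
      (fun x : ℝ × ℝ => (u x.2 * Real.cos (x.1 + φ)) • v) d.strip) d.strip
  | 0, F, _, _, u, hu, φ, v => by
    obtain ⟨K, hK0, hK⟩ := exists_bound_of_isHolderOn hu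
    obtain ⟨C, hC⟩ := hu
    refine ⟨(K * 2 + |C|) * ‖v‖, fun x hx y hy => ?_⟩
    rw [iteratedFDerivWithin_zero_eq_comp, Function.comp_apply, Function.comp_apply, ← map_sub,
      LinearIsometryEquiv.norm_map, ← sub_smul, norm_smul]
    have e : u x.2 * Real.cos (x.1 + φ) - u y.2 * Real.cos (y.1 + φ)
        = u x.2 * (Real.cos (x.1 + φ) - Real.cos (y.1 + φ))
          + (u x.2 - u y.2) * Real.cos (y.1 + φ) := by ring
    have hd1 : |x.1 - y.1| ≤ dist x y := by
      rw [← Real.dist_eq, Prod.dist_eq]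
      exact le_max_left _ _
    have hd2 : dist x.2 y.2 ≤ dist x y := by
      rw [Prod.dist_eq]
      exact le_max_right _ _
    have h1 : |Real.cos (x.1 + φ) - Real.cos (y.1 + φ)| ≤ 2 * dist x y ^ d.alpha := by
      refine (abs_cos_sub_cos_le_rpow d.alpha_pos.le d.alpha_lt_one.le _ _).trans ?_
      rw [add_sub_add_right_eq_sub]
      have := Real.rpow_le_rpow (abs_nonneg _) hd1 d.alpha_pos.le
      linarith
    have h2 : ‖u x.2 - u y.2‖ ≤ |C| * dist x y ^ d.alpha :=
      (hC _ hx.2 _ hy.2).trans (mul_le_mul (le_abs_self C)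
        (Real.rpow_le_rpow dist_nonneg hd2 d.alpha_pos.le) (Real.rpow_nonneg dist_nonneg _)
        (abs_nonneg _))
    have h3 : ‖u x.2 * Real.cos (x.1 + φ) - u y.2 * Real.cos (y.1 + φ)‖
        ≤ (K * 2 + |C|) * dist x y ^ d.alpha := by
      rw [e]
      refine (norm_add_le _ _).trans ?_
      rw [norm_mul, norm_mul]
      have a1 := mul_le_mul (hK x.2 hx.2) h1 (abs_nonneg _) hK0
      have a2 := mul_le_mul h2 (Real.abs_cos_le_one (y.1 + φ)) (abs_nonneg _)
        (mul_nonneg (abs_nonneg C) (Real.rpow_nonneg dist_nonneg _))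
      simp only [Real.norm_eq_abs] at a1 a2 ⊢
      linarith
    have := mul_le_mul_of_nonneg_right h3 (norm_nonneg v)
    linarith
  | k + 1, F, _, _, u, hu, φ, v => by
    obtain ⟨u', hu', hd⟩ := id hu
    obtain ⟨C1, h1⟩ := isHolderOn_iteratedFDerivWithin_separated hu' φ
      ((ContinuousLinearMap.snd ℝ ℝ ℝ).smulRight v)
    obtain ⟨C2, h2⟩ := isHolderOn_iteratedFDerivWithin_separated hu.of_succ (φ + Real.pi / 2)
      ((ContinuousLinearMap.fst ℝ ℝ ℝ).smulRight v)
    refine ⟨C1 + C2, fun x hx y hy => ?_⟩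
    have c1 := contDiffOn_separated hu' φ ((ContinuousLinearMap.snd ℝ ℝ ℝ).smulRight v)
    have c2 := contDiffOn_separated hu.of_succ (φ + Real.pi / 2)
      ((ContinuousLinearMap.fst ℝ ℝ ℝ).smulRight v)
    have hE : EqOn (fderivWithin ℝ (fun x : ℝ × ℝ => (u x.2 * Real.cos (x.1 + φ)) • v) d.strip)
        _ d.strip := fun z hz =>
      (hasFDerivWithinAt_separated hd φ v hz).fderivWithin (d.uniqueDiffOn_strip z hz)
    have hI : ∀ z ∈ d.strip, iteratedFDerivWithin ℝ k
        (fderivWithin ℝ (fun x : ℝ × ℝ => (u x.2 * Real.cos (x.1 + φ)) • v) d.strip) d.strip z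
        = _ := fun z hz => (iteratedFDerivWithin_congr hE hz k).trans
          (iteratedFDerivWithin_add_apply (c1 z hz) (c2 z hz) d.uniqueDiffOn_strip hz)
    -- Currying is isometric, so Hölder bounds for the k-th derivative of the differential are
    -- bounds for derivative k + 1.
    let L := (continuousMultilinearCurryRightEquiv' ℝ k (ℝ × ℝ) F).symm
    rw [iteratedFDerivWithin_succ_eq_comp_right d.uniqueDiffOn_strip hx,
      iteratedFDerivWithin_succ_eq_comp_right d.uniqueDiffOn_strip hy]
    refine ((congrArg norm (L.map_sub _ _).symm).trans (L.norm_map _)).trans_le ?_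
    rw [hI x hx, hI y hy, add_sub_add_comm, add_mul]
    exact (norm_add_le _ _).trans (add_le_add (h1 x hx y hy) (h2 x hx y hy))

/-! ### The null vector of the mode one -/

/-- The function `M(p) cos q` on the strip, extended by zero. -/
noncomputable def separated (d : WaveData) (M : ℝ → ℝ) : ℝ × ℝ → ℝ :=
  d.strip.indicator fun x => M x.2 * Real.cos x.1

theorem separated_apply (M : ℝ → ℝ) (hp : p ∈ d.I) (q : ℝ) :
    d.separated M (q, p) = M p * Real.cos q :=
  indicator_of_mem (s := d.strip) (a := (q, p)) ⟨mem_univ _, hp⟩ _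

theorem separated_mem_X {M : ℝ → ℝ} (hM : d.Reg 3 M) (h0 : M d.p0 = 0) : d.separated M ∈ d.X := by
  have hE : EqOn (d.separated M) (fun x : ℝ × ℝ => (M x.2 * Real.cos (x.1 + 0)) • (1 : ℝ))
      d.strip := fun x hx => by simp [separated, hx]
  have hsym : ∀ (q q' p : ℝ), Real.cos q' = Real.cos q →
      d.separated M (q', p) = d.separated M (q, p) := fun q q' p hq => by
    by_cases hp : p ∈ d.I
    · rw [separated_apply M hp, separated_apply M hp, hq]
    · rw [separated, indicator_of_notMem fun hx => hp hx.2, indicator_of_notMem fun hx => hp hx.2]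
  refine ⟨fun x hx => indicator_of_notMem hx _, fun q p => hsym _ _ _ (Real.cos_add_two_pi q),
    fun q p => hsym _ _ _ (Real.cos_neg q), fun q => ?_,
    (contDiffOn_separated (k := 3) hM 0 (1 : ℝ)).congr hE, ?_⟩
  · rw [separated_apply M d.p0_mem_I, h0, zero_mul]
  · obtain ⟨C, hC⟩ := isHolderOn_iteratedFDerivWithin_separated hM 0 (1 : ℝ)
    refine ⟨C, fun x hx y hy => ?_⟩
    rw [iteratedFDerivWithin_congr hE hx, iteratedFDerivWithin_congr hE hy]
    exact hC x hx y hy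

theorem exists_ne_zero_mem_nullSpace (h : d.IsThreshold eps) (hl : lam ∈ d.params eps)
    (hm : d.HasMode lam 1) : ∃ w ∈ d.nullSpace lam, w ≠ 0 := by
  obtain ⟨M, N, hP, h1⟩ := hm.exists_normalized h hl one_ne_zero
  let w : d.X := ⟨d.separated M, separated_mem_X (hP.reg h hl one_ne_zero) hP.bottom⟩
  have hw : ∀ q, ∀ p ∈ d.I, d.separated M (q, p) = M p * Real.cos q := fun q p hp =>
    separated_apply M hp q
  have hwp : ∀ q, ∀ p ∈ d.I, d.dp (d.separated M) (q, p)
      = (d.speed lam p ^ 3)⁻¹ * N p * Real.cos q := fun q p hp =>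
    d.D_eq hp (((hP.deriv_fst p hp).mul_const (Real.cos q)).congr (fun s hs => hw q s hs) (hw q p hp))
  have hwpp := fun q p (hp : p ∈ d.I) =>
    d.D_eq hp (((hP.hasDerivWithinAt_deriv h hl one_ne_zero hp).mul_const (Real.cos q)).congr
      (fun s hs => hwp q s hs) (hwp q p hp))
  have hwq : ∀ q, ∀ p ∈ d.I, dq (d.separated M) (q, p) = -(M p * Real.sin q) := fun q p hp => by
    have : (fun t => d.separated M (t, p)) = fun t => M p * Real.cos t := funext fun t => hw t p hp
    rw [dq, this]
    exact ((Real.hasDerivAt_cos q).const_mul (M p)).deriv.trans (mul_neg _ _)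
  have hwqq : ∀ q, ∀ p ∈ d.I, dq (dq (d.separated M)) (q, p) = -(M p * Real.cos q) :=
    fun q p hp => by
      have : (fun t => dq (d.separated M) (t, p)) = fun t => -(M p * Real.sin t) :=
        funext fun t => hwq t p hp
      rw [dq, this]
      exact ((Real.hasDerivAt_sin q).const_mul (M p)).neg.deriv
  -- The cosine has mean zero, so the nonlocal term drops out.
  have hdep : depth (d.separated M) = 0 := by
    have := integral_cos_natCast 1
    simp only [Nat.cast_one, one_mul, one_ne_zero, if_false] at this
    simp only [depth, hw _ 0 d.zero_mem_I]
    rw [intervalIntegral.integral_const_mul, this, mul_zero, mul_zero]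
  refine ⟨w, (mem_nullSpace_iff h hl w).2 ⟨fun q p hp => ?_, fun q => ?_⟩, fun h0 => ?_⟩
  · change d.speed lam p ^ 3 * d.dp (d.dp (d.separated M)) (q, p) + _ * d.dp (d.separated M) (q, p)
      = -(d.speed lam p * dq (dq (d.separated M)) (q, p))
        - d.stiff p * (d.separated M (q, p) - depth (d.separated M))
    have hpp : d.dp (d.dp (d.separated M)) (q, p) = _ := hwpp q p hp
    rw [hpp, hwp q p hp, hwqq q p hp, hdep, hw q p hp, D_H_eq hp]
    have := speed_pos h hl p
    push_cast
    field_simp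
    ring
  · change d.speed lam 0 ^ 3 * d.dp (d.separated M) (q, 0)
      = d.g * d.rho 0 * d.separated M (q, 0) - d.sigma * dq (dq (d.separated M)) (q, 0)
    rw [hwp q 0 d.zero_mem_I, hwqq q 0 d.zero_mem_I, hw q 0 d.zero_mem_I, hP.top]
    have := speed_pos h hl 0
    push_cast
    field_simp
    ring
  · have h2 : d.separated M (0, 0) = 0 := congrFun (congrArg Subtype.val h0) (0, 0)
    rw [hw 0 0 d.zero_mem_I, h1, Real.cos_zero] at h2
    norm_num at h2

end WaveData

/-! ### Dimension of the null space. -/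

namespace WaveData

variable {d : WaveData} {eps lam mu p : ℝ}

/-- The top values of the cosine coefficients with index in `S`, as a linear map. -/
noncomputable def topCoeff (d : WaveData) (lam : ℝ) (S : Finset ℕ) :
    d.nullSpace lam →ₗ[ℝ] (S → ℝ) where
  toFun w n := cosCoeff n (w : d.X) 0
  map_add' a b := by
    funext n
    have hi : ∀ w : d.X, IntervalIntegrable
        (fun q => (w : ℝ × ℝ → ℝ) (q, 0) * Real.cos ((n : ℕ) * q)) MeasureTheory.volume
        0 (2 * Real.pi) := fun w =>
      ((continuous_slice w.2.2.2.2.2.1.continuousOn d.zero_mem_I).mul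
        (by fun_prop)).intervalIntegrable _ _
    simp only [cosCoeff, Submodule.coe_add, Pi.add_apply, add_mul]
    exact intervalIntegral.integral_add (hi a) (hi b)
  map_smul' c a := by
    funext n
    simp only [cosCoeff, Submodule.coe_smul, Pi.smul_apply, smul_eq_mul, mul_assoc,
      intervalIntegral.integral_const_mul, RingHom.id_apply]

/-- The map `topCoeff` is injective: coefficients in S vanish with their top value (which needs n ≠
0), those outside S because no such mode exists, and the cosines are complete. -/
theorem rank_nullSpace_le (h : d.IsThreshold eps) (hl : lam ∈ d.params eps) {S : Finset ℕ}
    (h0 : 0 ∉ S) (hS : ∀ n, d.HasMode lam n → n ∈ S) :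
    Module.rank ℝ (d.nullSpace lam) ≤ S.card := by
  have hinj : Function.Injective (d.topCoeff lam S) := by
    refine (injective_iff_map_eq_zero (G := d.nullSpace lam) (d.topCoeff lam S)).2 fun w hw => ?_
    have hz : ∀ n : ℕ, ∀ p ∈ d.I, cosCoeff n (w : d.X) p = 0 := by
      intro n
      have hP := cosCoeff_isModePair h hl n w.2
      by_cases hn : n ∈ S
      · exact hP.eq_zero_of_top h hl (fun h1 => h0 (h1 ▸ hn)) (congrFun hw ⟨n, hn⟩)
      · intro p hp
        by_contra hne
        exact hn (hS n ⟨_, hP.isModeSolution h hl, p, hp, hne⟩)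
    obtain ⟨hout, hper, heven, -, hC, -⟩ := w.1.2
    refine Subtype.ext (Subtype.ext (funext fun x => ?_))
    obtain ⟨q, p⟩ := x
    by_cases hp : p ∈ d.I
    · exact eq_zero_of_cos_coeff_eq_zero (continuous_slice hC.continuousOn hp)
        (fun q => hper q p) (fun q => heven q p) (fun n => hz n p hp) q
    · exact hout _ fun hx => hp hx.2
  have := LinearMap.rank_le_of_injective _ hinj
  rwa [rank_fun', Fintype.card_coe] at this

/-- As soon as two modes occur, `not_three_modes` makes them exhaust the list. -/
theorem exists_finset_modes (h : d.IsThreshold eps) (hl : lam ∈ d.params eps)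
    (h0 : ¬ d.HasMode lam 0) :
    ∃ S : Finset ℕ, S.card ≤ 2 ∧ 0 ∉ S ∧ ∀ n, d.HasMode lam n → n ∈ S := by
  have hne : ∀ {n}, d.HasMode lam n → n ≠ 0 := fun hn h1 => h0 (h1 ▸ hn)
  by_cases hS : ∃ a b, a ≠ b ∧ d.HasMode lam a ∧ d.HasMode lam b
  · obtain ⟨a, b, hab, ha, hb⟩ := hS
    refine ⟨{a, b}, Finset.card_le_two, ?_, fun c hc => ?_⟩
    · simp only [Finset.mem_insert, Finset.mem_singleton, not_or]
      exact ⟨(hne ha).symm, (hne hb).symm⟩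
    · by_contra hmem
      simp only [Finset.mem_insert, Finset.mem_singleton, not_or] at hmem
      have hall : ∀ i, d.HasMode lam (![a, b, c] i) := by
        simp [Fin.forall_fin_succ, ha, hb, hc]
      refine not_three_modes h hl (n := ![a, b, c]) ?_ (fun i => hne (hall i)) hall
      intro i j hij
      fin_cases i <;> fin_cases j <;> simp_all
  · push Not at hS
    by_cases he : ∃ a, d.HasMode lam a
    · obtain ⟨a, ha⟩ := he
      refine ⟨{a}, by simp, by simpa using (hne ha).symm, fun c hc => ?_⟩
      by_contra hmem
      exact hS a c (fun hac => hmem (by simp [hac])) ha hc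
    · push Not at he
      exact ⟨∅, by simp, by simp, fun n hn => absurd hn (he n)⟩

/-- Beyond an admissible `λ_c` the energy form is nonnegative and zero is not an eigenvalue. -/
theorem IsLambdaC.energy_small (h : d.IsThreshold eps) (hl : lam ∈ d.params eps) {lamC : ℝ}
    (hC : d.IsLambdaC eps lamC) (hlt : lamC < lam) :
    (d.g * d.rho 0 + d.g * d.rhoSup * |d.p0|) * (∫ s in d.p0..0, (d.speed lam s ^ 3)⁻¹) ≤ 1 ∧
      ¬ d.HasMode lam 0 := by
  obtain ⟨k, hk⟩ := exists_isVariation h hl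
  rw [hasMode_zero_iff h hl hk]
  have hg := mul_pos d.g_pos d.rho_zero_pos
  have hR : 0 ≤ d.g * d.rhoSup * |d.p0| :=
    mul_nonneg (mul_nonneg d.g_pos.le d.rhoSup_nonneg) (abs_nonneg _)
  have hA : 0 ≤ ∫ s in d.p0..0, (d.speed lam s ^ 3)⁻¹ :=
    intervalIntegral.integral_nonneg d.p0_neg.le fun s _ => by
      have := speed_pos h hl s
      positivity
  rcases hC with hC | ⟨hconst, hzero⟩
  · have h1 := hC lam hl hlt
    have hlow := hk.lower_bound h hl
    rw [Ydot_eq h hl hk, lt_div_iff₀ (by linarith)] at h1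
    have h2 := mul_le_mul_of_nonneg_left hlow (add_nonneg hg.le hR)
    have hk0 : 0 ≤ k d.p0 := by linarith
    have h3 := mul_nonneg hk0 hR
    exact ⟨by linarith, fun h4 => by linarith⟩
  · have hD : ∀ p ∈ d.I, d.D d.rho p = 0 := fun p hp =>
      d.D_eq hp ((hasDerivWithinAt_const p d.I (d.rho 0)).congr hconst (hconst p hp))
    have hsup : d.rhoSup = 0 := by
      have : (fun p => |d.D d.rho p|) '' d.I = {0} := by
        rw [image_congr (g := fun _ => (0 : ℝ)) fun p hp => by rw [hD p hp, abs_zero]]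
        exact Nonempty.image_const ⟨0, d.zero_mem_I⟩ 0
      rw [rhoSup, this, csSup_singleton]
    have hst : ∀ p, d.stiff p = 0 := fun p => by
      rw [stiff, hD _ (d.clamp_mem p), mul_zero, neg_zero]
    have h1 := hk.eq d.p0 d.p0_mem_I
    simp only [hst, zero_mul, intervalIntegral.integral_zero, sub_zero,
      intervalIntegral.integral_mul_const] at h1
    have h2 := hzero.slope_pos h hl hk hlt
    refine ⟨?_, h2.ne⟩
    rw [hsup, mul_zero, zero_mul, add_zero]
    rw [h1] at h2
    linarith

end WaveData

theorem mainTheorem9 (d : WaveData) (eps : ℝ) (heps : d.IsThreshold eps)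
    (lamStar : ℝ) (hrange : lamStar ∈ d.params eps) (hstar : d.HasMode lamStar 1) :
    (¬ d.IsLambdaZero eps lamStar → Module.rank ℝ (d.nullSpace lamStar) ≤ 2) ∧
    (∀ lamC : ℝ, d.IsLambdaC eps lamC → lamC < lamStar →
      Module.rank ℝ (d.nullSpace lamStar) = 1) ∧
    (d.HasMode lamStar 0 ↔ d.IsLambdaZero eps lamStar) := by
  obtain ⟨k, hk⟩ := WaveData.exists_isVariation heps hrange
  have h3 : d.HasMode lamStar 0 ↔ d.IsLambdaZero eps lamStar :=
    (WaveData.hasMode_zero_iff heps hrange hk).trans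
      (WaveData.isLambdaZero_iff heps hrange hk).symm
  refine ⟨fun hne => ?_, fun lamC hC hlt => ?_, h3⟩
  · obtain ⟨S, hcard, h0, hS⟩ :=
      WaveData.exists_finset_modes heps hrange fun h => hne (h3.1 h)
    exact (WaveData.rank_nullSpace_le heps hrange h0 hS).trans (by exact_mod_cast hcard)
  · obtain ⟨hsmall, hno⟩ := hC.energy_small heps hrange hlt
    refine le_antisymm ?_ ?_
    · have := WaveData.rank_nullSpace_le heps hrange (S := {1}) (by simp) fun n hn =>
        Finset.mem_singleton.2 (WaveData.mode_unique heps hrange hsmall one_ne_zero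
          (fun h => hno (h ▸ hn)) hstar hn)
      simpa using this
    · obtain ⟨w, hw, hw0⟩ := WaveData.exists_ne_zero_mem_nullSpace heps hrange hstar
      have : Nontrivial (d.nullSpace lamStar) :=
        ⟨⟨w, hw⟩, 0, fun h => hw0 (congrArg Subtype.val h)⟩
      exact Cardinal.one_le_iff_pos.2 (rank_pos (R := ℝ) (M := d.nullSpace lamStar))
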